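/- **Theorem (single input case, ReLU-type activation).** For $a\ge 0$ and a Lévy measure $\rho$ on $(0,\infty)$ (a Borel measure with $\int_0^\infty\min(1,x)\,\rho(dx)<\infty$), let $\mathrm{ID}(a,\rho)$ be the infinitely divisible law on $[0,\infty)$ with Laplace transform $t\mapsto\exp\left(-ta-\int_0^\infty(1-e^{-wt})\,\rho(dw)\right)$, $t\ge0$, and let $\overline\rho(x)=\rho((x,\infty))$ for $x>0$. Let $L,d_{\mathrm{in}},d_{\mathrm{out}}\ge 1$, $\sigma_b\ge 0$, $\sigma_v>0$, and let $\phi:\mathbb R\to\mathbb R$ be positive homogeneous: $\phi(\gamma x)=\gamma\phi(x)$ for all $\gamma>0$, $x\in\mathbb R$. For each $l=1,\dots,L$ and $n\ge1$ let $\mu^{(l)}_n$ be a probability distribution on $[0,\infty)$. For each $\mathbf p=(p_1,\dots,p_L)$ of positive integers, put $p_0=d_{\mathrm{in}}$, $p_{L+1}=d_{\mathrm{out}}$, and consider the random feedforward network with pre-activations, at an input $\mathbf x\in\mathbb R^{d_{\mathrm{in}}}$, $$Z^{(1)}_k(\mathbf x;\mathbf p)=\sum_{j=1}^{d_{\mathrm{in}}}W^{(1)}_{jk}x_j+B^{(1)}_k,\qquad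 Z^{(l)}_k(\mathbf x;\mathbf p)=\sum_{j=1}^{p_{l-1}}W^{(l)}_{jk}\,\phi\left(Z^{(l-1)}_j(\mathbf x;\mathbf p)\right)+B^{(l)}_k\quad(2\le l\le L+1),$$ for $1\le k\le p_l$, where $W^{(l+1)}_{jk}=\sqrt{\lambda^{(l)}_{p_l,j}}\,V^{(l+1)}_{jk}$ for $0\le l\le L$, $\lambda^{(0)}_{p_0,j}=1/d_{\mathrm{in}}$, and all the variables $\lambda^{(l)}_{p_l,j}\sim\mu^{(l)}_{p_l}$ ($1\le l\le L$), $V^{(l)}_{jk}\sim\mathcal N(0,\sigma_v^2)$, $B^{(l)}_k\sim\mathcal N(0,\sigma_b^2)$ are mutually independent (with $\mathcal N(0,0)$ the point mass at $0$). Assume that for every $l=1,\dots,L$ there are $a^{(l)}\ge0$ and a Lévy measure $\rho^{(l)}$ with $$\sum_{j=1}^{p_l}\lambda^{(l)}_{p_l,j}\ \overset{d}{\to}\ \mathrm{ID}(a^{(l)},\rho^{(l)})\quad\text{as }p_l\to\infty .$$ Let $\varphi$ be the standard normal density. Then $\int\phi(z)^2\varphi(z)\,dz<\infty$; set $c^{(l)}=a^{(l)}\int_{-\infty}^\infty\phi(z)^2\varphi(z)\,dz$.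 There are Lévy measures $\eta^{(1)},\dots,\eta^{(L)}$ on $(0,\infty)$ with tails $$\overline\eta^{(l)}(x)=\int_{\{z:\phi(z)\ne0\}}\overline\rho^{(l)}\left(x/\phi(z)^2\right)\varphi(z)\,dz\qquad(x>0),$$ and the laws $\mathrm{ID}(c^{(l)},\eta^{(l)})$ exist. Let $S^{(1)},\dots,S^{(L)}$ be independent random variables, not depending on the input, with $S^{(l)}\sim\mathrm{ID}(c^{(l)},\eta^{(l)})$, and for $\mathbf x\in\mathbb R^{d_{\mathrm{in}}}$ put $$\Sigma^{(1)}(\mathbf x)=\sigma_b^2+\sigma_v^2\|\mathbf x\|^2/d_{\mathrm{in}},\qquad \Sigma^{(l)}(\mathbf x)=\sigma_b^2+\sigma_v^2\,S^{(l-1)}\,\Sigma^{(l-1)}(\mathbf x)\quad(l=2,\dots,L+1).$$ Then $(\Sigma^{(1)}(\mathbf x),\dots,\Sigma^{(L+1)}(\mathbf x))$ is a Markov sequence of (almost surely) nonnegative random variables, and for every $\mathbf x\in\mathbb R^{d_{\mathrm{in}}}$, every layer $l=1,\dots,L+1$ and every $m\ge1$ (with $m\le d_{\mathrm{out}}$ if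 $l=L+1$), as $\min(p_1,\dots,p_L)\to\infty$, $$\left(Z^{(l)}_1(\mathbf x;\mathbf p),\dots,Z^{(l)}_m(\mathbf x;\mathbf p)\right)\ \overset{d}{\to}\ \mathbf E\left[\bigotimes_{k=1}^m\mathcal N\left(0,\Sigma^{(l)}(\mathbf x)\right)\right].$$ -/

import Mathlib

open MeasureTheory ProbabilityTheory Filter Topology
open scoped NNReal ENNReal

noncomputable section

namespace WideNet

/-! ### Convergence in distribution, Lévy measures, infinitely divisible laws -/

/-- The laws `μ i` converge in distribution to the law `ν` along the filter `F`; all of them are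
required to be probability measures. -/
def ConvergesInLaw {ι E : Type*} [MeasurableSpace E] [TopologicalSpace E] [OpensMeasurableSpace E]
    (μ : ι → Measure E) (F : Filter ι) (ν : Measure E) : Prop :=
  ∃ (hμ : ∀ i, IsProbabilityMeasure (μ i)) (hν : IsProbabilityMeasure ν),
    Tendsto (β := ProbabilityMeasure E) (fun i => ⟨μ i, hμ i⟩) F (𝓝 ⟨ν, hν⟩)

/-- `ρ` is a Lévy measure on `(0, ∞)`: a Borel measure on the line that is carried by `(0, ∞)` and
satisfies `∫ min(1, x) ρ(dx) < ∞`. -/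
structure IsLevyMeasure (ρ : Measure ℝ) : Prop where
  null_nonpos : ρ (Set.Iic 0) = 0
  lintegral_min_lt_top : ∫⁻ x, ENNReal.ofReal (min 1 x) ∂ρ < ∞

/-- `ν` is the nonnegative infinitely divisible law `ID(a, ρ)` with location parameter `a ≥ 0` and
Lévy measure `ρ` on `(0, ∞)`: the probability law on `[0, ∞)` with Laplace transform
`t ↦ exp (- t a - ∫ (1 - exp (- w t)) ρ(dw))`, `t ≥ 0`. -/
structure IsIDLaw (ν : Measure ℝ) (a : ℝ) (ρ : Measure ℝ) : Prop where
  isProbabilityMeasure : IsProbabilityMeasure ν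
  null_neg : ν (Set.Iio 0) = 0
  location_nonneg : 0 ≤ a
  isLevyMeasure : IsLevyMeasure ρ
  laplace : ∀ t : ℝ, 0 ≤ t →
    ∫ x, Real.exp (-(t * x)) ∂ν = Real.exp (-(t * a) - ∫ w, (1 - Real.exp (-(w * t))) ∂ρ)

/-- The law of the sum of `n` independent random variables with law `μ`. -/
def iidSumLaw (μ : Measure ℝ) (n : ℕ) : Measure ℝ :=
  (Measure.pi (fun _ : Fin n => μ)).map (fun y => ∑ j, y j)

/-- The real random variables `X 0, …, X n` form a Markov sequence: conditionally on the whole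
past, the law of the next variable is its law conditionally on the present variable. -/
def IsMarkovSequence {Ω : Type*} [MeasurableSpace Ω] {n : ℕ} (X : Fin (n + 1) → Ω → ℝ)
    (P : Measure Ω) : Prop :=
  (∀ i, Measurable (X i)) ∧
    ∀ (i : Fin n) (A : Set ℝ), MeasurableSet A →
      P⟦X i.succ ⁻¹' A | ⨆ j : {j : Fin (n + 1) // j ≤ i.castSucc},
          MeasurableSpace.comap (X j) inferInstance⟧
        =ᵐ[P] P⟦X i.succ ⁻¹' A | MeasurableSpace.comap (X i.castSucc) inferInstance⟧

/-! ### The feedforward network -/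

/-- `φ (γ x) = γ φ x` for all `γ > 0` and all real `x`. -/
def PositiveHomogeneous (φ : ℝ → ℝ) : Prop :=
  ∀ γ x : ℝ, 0 < γ → φ (γ * x) = γ * φ x

/-- The number of nodes of layer `l` in a network with `L` hidden layers of widths `p`:
`din` for `l = 0`, the `l`-th hidden width for `1 ≤ l ≤ L`, and `dout` for `l = L + 1`. -/
def layerWidth (din dout : ℕ) {L : ℕ} (p : Fin L → ℕ+) : ℕ → ℕ
  | 0 => din
  | l + 1 => if h : l < L then (p ⟨l, h⟩ : ℕ) else dout

/-- The names of the random parameters of a network with hidden widths `p`.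
Layers and nodes are counted from `0` here: `nodeVar l j` names the variance parameter of node `j`
of hidden layer `l + 1`; `gauss l j k` names the Gaussian variable of the edge from node `j` of
layer `l` to node `k` of layer `l + 1`; `bias l k` names the bias of node `k` of layer `l + 1`. -/
inductive ParamIdx (din dout : ℕ) {L : ℕ} (p : Fin L → ℕ+) : Type
  | nodeVar (l : Fin L) (j : Fin (layerWidth din dout p (l + 1)))
  | gauss (l : Fin (L + 1)) (j : Fin (layerWidth din dout p l))
      (k : Fin (layerWidth din dout p (l + 1)))
  | bias (l : Fin (L + 1)) (k : Fin (layerWidth din dout p (l + 1)))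

section Forward

variable {din dout L : ℕ} {p : Fin L → ℕ+}

/-- The variance parameter of node `j` of layer `l`; it is `1 / din` in the input layer. -/
def nodeVariance (θ : ParamIdx din dout p → ℝ) :
    (l : ℕ) → l < L + 1 → Fin (layerWidth din dout p l) → ℝ
  | 0, _, _ => 1 / (din : ℝ)
  | l + 1, h, j => θ (.nodeVar ⟨l, Nat.lt_of_succ_lt_succ h⟩ j)

/-- The weight of the edge from node `j` of layer `l` to node `k` of layer `l + 1`. -/
def weight (θ : ParamIdx din dout p → ℝ) (l : ℕ) (h : l < L + 1)
    (j : Fin (layerWidth din dout p l)) (k : Fin (layerWidth din dout p (l + 1))) : ℝ :=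
  √(nodeVariance θ l h j) * θ (.gauss ⟨l, h⟩ j k)

/-- The pre-activations of layer `l + 1` at the input `x`. -/
def preact (φ : ℝ → ℝ) (x : EuclideanSpace ℝ (Fin din)) (θ : ParamIdx din dout p → ℝ) :
    (l : ℕ) → l < L + 1 → Fin (layerWidth din dout p (l + 1)) → ℝ
  | 0, h, k => ∑ j : Fin din, weight θ 0 h j k * x j + θ (.bias ⟨0, h⟩ k)
  | l + 1, h, k =>
      ∑ j, weight θ (l + 1) h j k * φ (preact φ x θ l (Nat.lt_of_succ_lt h) j)
        + θ (.bias ⟨l + 1, h⟩ k)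

/-- The first `m` pre-activations of layer `l + 1` (padded with zeros should that layer have fewer
than `m` nodes). -/
def firstPreacts (φ : ℝ → ℝ) (x : EuclideanSpace ℝ (Fin din)) (l : Fin (L + 1)) (m : ℕ)
    (θ : ParamIdx din dout p → ℝ) : Fin m → ℝ :=
  fun k => if h : (k : ℕ) < layerWidth din dout p (l + 1) then preact φ x θ l l.isLt ⟨k, h⟩ else 0

end Forward

/-- The distribution of the parameters of a random network: the family of all parameters is
independent, node variances at hidden layer `l + 1` have law `μ l n` where `n` is the width of that
layer, and the Gaussian variables and the biases are centred with variances `σv ^ 2` and `σb ^ 2`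
(a Gaussian with variance zero is the constant `0`). -/
structure IsRandomNetwork {din dout L : ℕ} (p : Fin L → ℕ+) (σb σv : ℝ≥0)
    (μ : Fin L → ℕ+ → Measure ℝ) {Ω : Type*} [MeasurableSpace Ω] (P : Measure Ω)
    (θ : ParamIdx din dout p → Ω → ℝ) : Prop where
  indep : iIndepFun θ P
  law_nodeVar : ∀ l j, HasLaw (θ (.nodeVar l j)) (μ l (p l)) P
  law_gauss : ∀ l j k, HasLaw (θ (.gauss l j k)) (gaussianReal 0 (σv ^ 2)) P
  law_bias : ∀ l k, HasLaw (θ (.bias l k)) (gaussianReal 0 (σb ^ 2)) P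

/-! ### The limit -/

/-- The second moment `∫ φ(z)² e^{-z²/2} / √(2π) dz`. -/
def gaussianMeanSq (φ : ℝ → ℝ) : ℝ :=
  ∫ z, φ z ^ 2 * gaussianPDFReal 0 1 z

/-- The limiting variance of layer `l + 1` at the input `x`, as a function of the values
`s 0, …, s (L - 1)` of the multipliers attached to the hidden layers `1, …, L`. -/
def limitVariance (σb σv : ℝ≥0) {din L : ℕ} (x : EuclideanSpace ℝ (Fin din)) (s : Fin L → ℝ) :
    (l : ℕ) → l < L + 1 → ℝ
  | 0, _ => (σb : ℝ) ^ 2 + (σv : ℝ) ^ 2 * ‖x‖ ^ 2 / din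
  | l + 1, h => (σb : ℝ) ^ 2 + (σv : ℝ) ^ 2 * s ⟨l, Nat.lt_of_succ_lt_succ h⟩
      * limitVariance σb σv x s l (Nat.lt_of_succ_lt h)

/-- The mixture `E[N(0, V) ⊗ ⋯ ⊗ N(0, V)]` (`m` factors) with random variance `V`. -/
def gaussianMixture {Ω : Type*} [MeasurableSpace Ω] (Q : Measure Ω) (V : Ω → ℝ) (m : ℕ) :
    Measure (Fin m → ℝ) :=
  Q.bind (fun ω => Measure.pi (fun _ : Fin m => gaussianReal 0 (V ω).toNNReal))

end WideNet

end

/-!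
The theorem rests on an exact description of the network at finite width. Conditionally on the
layers below and on the node variances, the pre-activations of a layer are independent centred
Gaussians with the common variance `σb² + σv² ∑ λ_j φ(Z_j)²`, the sum running over the nodes of the
layer below. If that layer is itself a Gaussian mixture, `Z_j = √v ζ_j` with `ζ` standard normal,
positive homogeneity turns the sum into `v T` with `T = ∑ λ_j φ(ζ_j)²` independent of `v`. Hence
every layer is, at every width, a Gaussian mixture whose variance follows the recursion
`v ↦ σb² + σv² T v` with independent multipliers `T` (`map_layerOut_gaussianMixture`, `map_preact`);
the limit in the theorem obeys the same recursion (`map_limitVariance`). Since the recursion and the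
mixture are continuous images of product measures, they pass to weak limits
(`convergesInLaw_varianceLaw`, `ConvergesInLaw.gaussianMixture`), and only the convergence of the
multipliers has to be shown, one layer at a time.

The multiplier of a layer of width `n` is a sum of `n` independent copies of `λ φ(ζ)²`. Let
`ψ t = t a + ∫ (1 - exp (- w t)) ρ(dw)` be the exponent of `ID(a, ρ)`. The hypothesis on the sums of
the `λ_j` says that `n (1 - E exp (- t λ)) → ψ t`. Averaging this at `t φ(ζ)²` by dominated
convergence gives the exponent `E ψ (t φ(ζ)²)` for the limit of the multipliers
(`tendsto_laplace_iidSumLaw_activatedLaw`), which is that of `ID(c, η)` with `c = a E φ(ζ)²` and `η`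
the image of `ρ` under multiplication by `φ(ζ)²` (`integral_laplaceExponent_mul_sq`). A continuity
theorem for Laplace transforms on `[0, ∞)` (`exists_laplace_eq_of_tendsto`,
`convergesInLaw_of_laplace`), obtained from Prokhorov's theorem and the Stone–Weierstrass theorem,
gives both the existence of `ID(c, η)` and the convergence of the multipliers.

The Markov property holds because the limiting variances are built recursively from independent
innovations (`isMarkovSequence_of_recursion`).
-/

namespace WideNet

/-! ### Laplace transforms of laws on the half-line -/

/-- The Laplace transform `t ↦ ∫ exp (-t x) m(dx)` of a measure on the line. -/
noncomputable def laplace (m : Measure ℝ) (t : ℝ) : ℝ := ∫ x, Real.exp (-(t * x)) ∂m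

lemma ae_nonneg_of_null_neg {m : Measure ℝ} (h : m (Set.Iio 0) = 0) : ∀ᵐ x ∂m, 0 ≤ x := by
  rw [ae_iff]; simpa [Set.Iio] using h

lemma integrable_exp_neg_mul {m : Measure ℝ} [IsFiniteMeasure m] (h : m (Set.Iio 0) = 0) {t : ℝ}
    (ht : 0 ≤ t) : Integrable (fun x => Real.exp (-(t * x))) m := by
  refine Integrable.mono' (integrable_const 1) (by fun_prop) ?_
  filter_upwards [ae_nonneg_of_null_neg h] with x hx
  rw [Real.norm_of_nonneg (Real.exp_nonneg _)]
  exact Real.exp_le_one_iff.2 (by have := mul_nonneg ht hx; linarith)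

lemma laplace_le_one {m : Measure ℝ} [IsProbabilityMeasure m] (h : m (Set.Iio 0) = 0) {t : ℝ}
    (ht : 0 ≤ t) : laplace m t ≤ 1 := by
  have : laplace m t ≤ ∫ _, (1 : ℝ) ∂m := by
    refine integral_mono_ae (integrable_exp_neg_mul h ht) (integrable_const 1) ?_
    filter_upwards [ae_nonneg_of_null_neg h] with x hx
    exact Real.exp_le_one_iff.2 (by have := mul_nonneg ht hx; linarith)
  simpa using this

lemma laplace_pos {m : Measure ℝ} [IsProbabilityMeasure m] (h : m (Set.Iio 0) = 0) {t : ℝ}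
    (ht : 0 ≤ t) : 0 < laplace m t :=
  integral_exp_pos (integrable_exp_neg_mul h ht)

/-- A Markov-type bound: the tail of a law on `[0, ∞)` is controlled by its Laplace transform near
zero. -/
lemma measure_gt_le_laplace {m : Measure ℝ} [IsProbabilityMeasure m] (h : m (Set.Iio 0) = 0) {r : ℝ}
    (hr : 0 < r) : m {x | r < ‖x‖} ≤
      ENNReal.ofReal ((1 - Real.exp (-1))⁻¹ * (1 - laplace m r⁻¹)) := by
  have hc : 0 < 1 - Real.exp (-1) := by
    have : Real.exp (-1) < 1 := Real.exp_lt_one_iff.2 (by norm_num)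
    linarith
  have hi : Integrable (fun x => 1 - Real.exp (-(r⁻¹ * x))) m :=
    (integrable_const 1).sub (integrable_exp_neg_mul h (by positivity))
  have hnn : 0 ≤ᵐ[m] fun x => 1 - Real.exp (-(r⁻¹ * x)) := by
    filter_upwards [ae_nonneg_of_null_neg h] with x hx
    have : Real.exp (-(r⁻¹ * x)) ≤ 1 := Real.exp_le_one_iff.2 (by
      have := mul_nonneg (inv_nonneg.2 hr.le) hx; linarith)
    simpa using this
  have key := mul_meas_ge_le_integral_of_nonneg hnn hi (1 - Real.exp (-1))
  have hint : ∫ x, (1 - Real.exp (-(r⁻¹ * x))) ∂m = 1 - laplace m r⁻¹ := by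
    rw [integral_sub (integrable_const 1) (integrable_exp_neg_mul h (by positivity))]
    simp [laplace]
  rw [hint] at key
  have hsub : m {x | r < ‖x‖} ≤ m {x | 1 - Real.exp (-1) ≤ 1 - Real.exp (-(r⁻¹ * x))} := by
    refine measure_mono_ae ?_
    filter_upwards [ae_nonneg_of_null_neg h] with x hx hxr
    have hxr' : r < x := by
      have h2 : r < ‖x‖ := hxr
      rwa [Real.norm_of_nonneg hx] at h2
    have h1 : 1 ≤ r⁻¹ * x := by
      rw [inv_mul_eq_div, le_div_iff₀ hr]; linarith
    have : Real.exp (-(r⁻¹ * x)) ≤ Real.exp (-1) := Real.exp_le_exp.2 (by linarith)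
    show 1 - Real.exp (-1) ≤ 1 - Real.exp (-(r⁻¹ * x))
    linarith
  refine hsub.trans ?_
  rw [← ofReal_measureReal]
  refine ENNReal.ofReal_le_ofReal ?_
  rw [inv_mul_eq_div, le_div_iff₀ hc, mul_comm]
  exact key

/-- Laws on `[0, ∞)` whose Laplace transforms converge to a function that is continuous at zero
form a tight sequence. -/
lemma isTightMeasureSet_of_laplace {m : ℕ → Measure ℝ} [∀ n, IsProbabilityMeasure (m n)]
    (h : ∀ n, m n (Set.Iio 0) = 0) {g : ℝ → ℝ} (hg : Tendsto g (𝓝[>] 0) (𝓝 1))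
    (hm : ∀ t, 0 < t → Tendsto (fun n => laplace (m n) t) atTop (𝓝 (g t))) :
    IsTightMeasureSet (Set.range m) := by
  refine isTightMeasureSet_range_of_tendsto_limsup_measure_norm_gt ?_
  have hlim : Tendsto (fun r : ℝ => ENNReal.ofReal ((1 - Real.exp (-1))⁻¹ * (1 - g r⁻¹))) atTop
      (𝓝 0) := by
    have : Tendsto (fun r : ℝ => (1 - Real.exp (-1))⁻¹ * (1 - g r⁻¹)) atTop (𝓝 0) := by
      simpa using ((hg.comp tendsto_inv_atTop_nhdsGT_zero).const_sub 1).const_mul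
        (1 - Real.exp (-1))⁻¹
    simpa using ENNReal.tendsto_ofReal this
  refine tendsto_of_tendsto_of_tendsto_of_le_of_le' tendsto_const_nhds hlim
    (Eventually.of_forall fun _ => zero_le) ?_
  filter_upwards [eventually_gt_atTop 0] with r hr
  have h1 : Tendsto (fun n => ENNReal.ofReal ((1 - Real.exp (-1))⁻¹ * (1 - laplace (m n) r⁻¹)))
      atTop (𝓝 (ENNReal.ofReal ((1 - Real.exp (-1))⁻¹ * (1 - g r⁻¹)))) :=
    ENNReal.tendsto_ofReal (((hm _ (inv_pos.2 hr)).const_sub 1).const_mul _)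
  rw [← h1.limsup_eq]
  exact limsup_le_limsup (Eventually.of_forall fun n => measure_gt_le_laplace (h n) hr)

/-- The bounded continuous function `x ↦ exp (-x)` on `[0, ∞)`. -/
noncomputable def expNeg : BoundedContinuousFunction ℝ≥0 ℝ :=
  BoundedContinuousFunction.ofNormedAddCommGroup (fun x : ℝ≥0 => Real.exp (-(x : ℝ)))
    (by fun_prop) 1 (fun x => by
      rw [Real.norm_of_nonneg (Real.exp_nonneg _)]
      exact Real.exp_le_one_iff.2 (by simp))

lemma expNeg_pow_apply (k : ℕ) (x : ℝ≥0) : (expNeg ^ k) x = Real.exp (-(k * (x : ℝ))) := by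
  rw [BoundedContinuousFunction.pow_apply]
  change Real.exp (-(x : ℝ)) ^ k = _
  rw [← Real.exp_nat_mul]; ring_nf

lemma integral_expNeg_pow {m : Measure ℝ} (h : m (Set.Iio 0) = 0) (k : ℕ) :
    ∫ x, (expNeg ^ k) x ∂(m.map Real.toNNReal) = laplace m k := by
  rw [integral_map (by fun_prop) (by fun_prop)]
  refine integral_congr_ae ?_
  filter_upwards [ae_nonneg_of_null_neg h] with x hx
  rw [expNeg_pow_apply, Real.coe_toNNReal x hx]

lemma map_toNNReal_map_coe {m : Measure ℝ} (h : m (Set.Iio 0) = 0) :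
    (m.map Real.toNNReal).map ((↑) : ℝ≥0 → ℝ) = m := by
  rw [Measure.map_map (by fun_prop) (by fun_prop)]
  conv_rhs => rw [← Measure.map_id (μ := m)]
  refine Measure.map_congr ?_
  filter_upwards [ae_nonneg_of_null_neg h] with x hx
  simp [Real.coe_toNNReal x hx]

lemma tendsto_integral_adjoin_expNeg {ι : Type*} {F : Filter ι} {m : ι → ProbabilityMeasure ℝ≥0}
    {ν : ProbabilityMeasure ℝ≥0}
    (hm : ∀ k : ℕ, Tendsto (fun n => ∫ x, (expNeg ^ k) x ∂(m n : Measure ℝ≥0)) F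
      (𝓝 (∫ x, (expNeg ^ k) x ∂(ν : Measure ℝ≥0))))
    {f : BoundedContinuousFunction ℝ≥0 ℝ} (hf : f ∈ StarAlgebra.adjoin ℝ {expNeg}) :
    Tendsto (fun n => ∫ x, f x ∂(m n : Measure ℝ≥0)) F (𝓝 (∫ x, f x ∂(ν : Measure ℝ≥0))) := by
  have hstar : star expNeg = expNeg := by ext x; simp
  have hf' : f ∈ Algebra.adjoin ℝ {expNeg} := by
    have : f ∈ (StarAlgebra.adjoin ℝ {expNeg}).toSubalgebra := hf
    rw [StarAlgebra.adjoin_toSubalgebra] at this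
    simpa only [Set.star_singleton, hstar, Set.union_self] using this
  have hspan : f ∈ Submodule.span ℝ (Submonoid.powers expNeg : Set _) := by
    have h1 : f ∈ Subalgebra.toSubmodule (Algebra.adjoin ℝ {expNeg}) := hf'
    rw [Algebra.adjoin_eq_span] at h1
    rwa [Submonoid.powers_eq_closure]
  clear hf hf'
  induction hspan using Submodule.span_induction with
  | mem f hf =>
    obtain ⟨k, rfl⟩ := hf
    exact hm k
  | zero => simpa using tendsto_const_nhds
  | add f g _ _ hf hg =>
    have e (P : ProbabilityMeasure ℝ≥0) : ∫ x, (f + g) x ∂(P : Measure ℝ≥0)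
        = ∫ x, f x ∂(P : Measure ℝ≥0) + ∫ x, g x ∂(P : Measure ℝ≥0) :=
      integral_add (f.integrable _) (g.integrable _)
    simp only [e]
    exact hf.add hg
  | smul c f _ hf =>
    have e (P : ProbabilityMeasure ℝ≥0) : ∫ x, (c • f) x ∂(P : Measure ℝ≥0)
        = c * ∫ x, f x ∂(P : Measure ℝ≥0) :=
      integral_const_mul c _
    simp only [e]
    exact hf.const_mul c

/-- Along a tight sequence of laws on `[0, ∞)`, convergence of the Laplace transforms at the
integers is convergence in distribution: polynomials in `exp (-x)` separate the points of
`[0, ∞)`. -/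
lemma convergesInLaw_of_laplace_of_tight {m : ℕ → Measure ℝ} (hm : ∀ n, IsProbabilityMeasure (m n))
    (h : ∀ n, m n (Set.Iio 0) = 0) (ht : IsTightMeasureSet (Set.range m))
    {ν : Measure ℝ} (hν : IsProbabilityMeasure ν) (hν0 : ν (Set.Iio 0) = 0)
    (hL : ∀ k : ℕ, Tendsto (fun n => laplace (m n) k) atTop (𝓝 (laplace ν k))) :
    ConvergesInLaw m atTop ν := by
  refine ⟨hm, hν, ?_⟩
  -- On the whole line `exp (-x)` is unbounded, so the laws are transferred to `ℝ≥0`.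
  let m' : ℕ → ProbabilityMeasure ℝ≥0 := fun n =>
    ProbabilityMeasure.map ⟨m n, hm n⟩ (f := Real.toNNReal) (by fun_prop)
  let ν' : ProbabilityMeasure ℝ≥0 :=
    ProbabilityMeasure.map ⟨ν, hν⟩ (f := Real.toNNReal) (by fun_prop)
  have key : Tendsto m' atTop (𝓝 ν') := by
    refine ProbabilityMeasure.tendsto_of_tight_of_separatesPoints ℝ ?_
      (A := StarAlgebra.adjoin ℝ {expNeg}) ?_ ?_
    · convert ht.map continuous_real_toNNReal using 1
      rw [← Set.range_comp]; rfl
    · intro x y hxy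
      refine ⟨expNeg, ⟨_, ⟨expNeg, StarAlgebra.subset_adjoin _ _ rfl, rfl⟩, rfl⟩, ?_⟩
      intro he
      have he' : Real.exp (-(x : ℝ)) = Real.exp (-(y : ℝ)) := he
      exact hxy (by simpa using Real.exp_injective he')
    · intro f hf
      refine tendsto_integral_adjoin_expNeg (fun k => ?_) hf
      have e1 n : ∫ x, (expNeg ^ k) x ∂(m' n : Measure ℝ≥0) = laplace (m n) k :=
        integral_expNeg_pow (h n) k
      have e2 : ∫ x, (expNeg ^ k) x ∂(ν' : Measure ℝ≥0) = laplace ν k :=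
        integral_expNeg_pow hν0 k
      simp only [e1, e2]
      exact hL k
  have := ProbabilityMeasure.tendsto_map_of_tendsto_of_continuous m' ν' key
    (f := ((↑) : ℝ≥0 → ℝ)) NNReal.continuous_coe
  have e1 : (fun n => (⟨m n, hm n⟩ : ProbabilityMeasure ℝ)) =
      fun n => (m' n).map NNReal.continuous_coe.measurable.aemeasurable :=
    funext fun n => Subtype.ext (map_toNNReal_map_coe (h n)).symm
  have e2 : (⟨ν, hν⟩ : ProbabilityMeasure ℝ) =
      ν'.map NNReal.continuous_coe.measurable.aemeasurable :=
    Subtype.ext (map_toNNReal_map_coe hν0).symm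
  rw [e1, e2]
  exact this

/-- Weak limits of laws on `[0, ∞)` are carried by `[0, ∞)`, and their Laplace transforms are the
limits of the Laplace transforms. -/
lemma null_neg_and_tendsto_laplace {ι : Type*} {F : Filter ι} [F.NeBot]
    {m : ι → ProbabilityMeasure ℝ}
    (h : ∀ n, (m n : Measure ℝ) (Set.Iio 0) = 0) {ν : ProbabilityMeasure ℝ}
    (hm : Tendsto m F (𝓝 ν)) : (ν : Measure ℝ) (Set.Iio 0) = 0 ∧
      ∀ t, 0 ≤ t → Tendsto (fun n => laplace (m n) t) F (𝓝 (laplace ν t)) := by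
  have h0 : (ν : Measure ℝ) (Set.Iio 0) = 0 := by
    have := ProbabilityMeasure.le_liminf_measure_open_of_tendsto hm (G := Set.Iio (0 : ℝ))
      isOpen_Iio
    simpa [h] using this
  refine ⟨h0, fun t ht => ?_⟩
  let f : BoundedContinuousFunction ℝ ℝ :=
    BoundedContinuousFunction.ofNormedAddCommGroup (fun x : ℝ => Real.exp (-(t * max x 0)))
      (by fun_prop) 1 (fun x => by
        rw [Real.norm_of_nonneg (Real.exp_nonneg _)]
        exact Real.exp_le_one_iff.2 (by
          have := mul_nonneg ht (le_max_right x 0); linarith))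
  have e {P : Measure ℝ} (hP : P (Set.Iio 0) = 0) : ∫ x, f x ∂P = laplace P t := by
    refine integral_congr_ae ?_
    filter_upwards [ae_nonneg_of_null_neg hP] with x hx
    change Real.exp (-(t * max x 0)) = _
    rw [max_eq_left hx]
  have := (ProbabilityMeasure.tendsto_iff_forall_integral_tendsto.1 hm) f
  simpa only [e (h _), e h0] using this

/-- A pointwise limit of Laplace transforms of laws on `[0, ∞)` that is continuous at zero is again
the Laplace transform of such a law: by Prokhorov's theorem the laws have a cluster point. -/
theorem exists_laplace_eq_of_tendsto {m : ℕ → Measure ℝ} (hm : ∀ n, IsProbabilityMeasure (m n))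
    (h : ∀ n, m n (Set.Iio 0) = 0) {g : ℝ → ℝ} (hg : Tendsto g (𝓝[>] 0) (𝓝 1))
    (hL : ∀ t, 0 ≤ t → Tendsto (fun n => laplace (m n) t) atTop (𝓝 (g t))) :
    ∃ ν : Measure ℝ, IsProbabilityMeasure ν ∧ ν (Set.Iio 0) = 0 ∧
      (∀ t, 0 ≤ t → laplace ν t = g t) := by
  have ht := isTightMeasureSet_of_laplace h hg fun t ht => hL t ht.le
  let m' : ℕ → ProbabilityMeasure ℝ := fun n => ⟨m n, hm n⟩
  have hc : IsCompact (closure (Set.range m')) :=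
    isCompact_closure_of_isTightMeasureSet (by
      convert ht using 1
      ext P
      exact ⟨fun ⟨_, ⟨n, hn⟩, hP⟩ => ⟨n, by rw [← hP, ← hn]; rfl⟩,
        fun ⟨n, hn⟩ => ⟨m' n, ⟨n, rfl⟩, hn⟩⟩)
  obtain ⟨ν, -, hν⟩ := hc.ultrafilter_le_nhds ((Ultrafilter.of (atTop : Filter ℕ)).map m')
    ((le_principal_iff.2 (Ultrafilter.mem_map.2 (Eventually.of_forall fun n =>
      subset_closure (Set.mem_range_self n)))))
  have hν' : Tendsto m' (Ultrafilter.of (atTop : Filter ℕ)) (𝓝 ν) := hν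
  obtain ⟨h0, hlap⟩ := null_neg_and_tendsto_laplace (m := m') (fun n => h n) hν'
  exact ⟨ν, inferInstance, h0, fun t ht =>
    tendsto_nhds_unique (hlap t ht) ((hL t ht).mono_left (Ultrafilter.of_le _))⟩

/-- The continuity theorem for Laplace transforms of laws on `[0, ∞)`. -/
theorem convergesInLaw_of_laplace {m : ℕ → Measure ℝ} (hm : ∀ n, IsProbabilityMeasure (m n))
    (h : ∀ n, m n (Set.Iio 0) = 0) {g : ℝ → ℝ} (hg : Tendsto g (𝓝[>] 0) (𝓝 1))
    (hL : ∀ t, 0 ≤ t → Tendsto (fun n => laplace (m n) t) atTop (𝓝 (g t)))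
    {ν : Measure ℝ} (hν : IsProbabilityMeasure ν) (hν0 : ν (Set.Iio 0) = 0)
    (hνL : ∀ t, 0 ≤ t → laplace ν t = g t) : ConvergesInLaw m atTop ν := by
  refine convergesInLaw_of_laplace_of_tight hm h
    (isTightMeasureSet_of_laplace h hg fun t ht => hL t ht.le) hν hν0 fun k => ?_
  rw [hνL k k.cast_nonneg]
  exact hL k k.cast_nonneg

/-! ### Sums of independent copies -/

lemma measurable_finSum (n : ℕ) : Measurable (fun y : Fin n → ℝ => ∑ j, y j) := by fun_prop

lemma isProbabilityMeasure_iidSumLaw (m : Measure ℝ) [IsProbabilityMeasure m] (n : ℕ) :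
    IsProbabilityMeasure (iidSumLaw m n) :=
  Measure.isProbabilityMeasure_map (measurable_finSum n).aemeasurable

lemma iidSumLaw_null_neg {m : Measure ℝ} [IsProbabilityMeasure m] (h : m (Set.Iio 0) = 0) (n : ℕ) :
    iidSumLaw m n (Set.Iio 0) = 0 := by
  rw [iidSumLaw, Measure.map_apply (measurable_finSum n) measurableSet_Iio]
  have hall : ∀ᵐ y ∂(Measure.pi fun _ : Fin n => m), ∀ j, 0 ≤ y j :=
    ae_all_iff.2 fun j => (measurePreserving_eval (fun _ : Fin n => m) j).quasiMeasurePreserving.ae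
      (ae_nonneg_of_null_neg h)
  refine measure_mono_null (t := {y | ¬ ∀ j, 0 ≤ y j}) (fun y hy hy' => ?_) hall
  exact absurd (Finset.sum_nonneg fun j _ => hy' j) (not_le.2 hy)

lemma laplace_iidSumLaw (m : Measure ℝ) [IsProbabilityMeasure m] (n : ℕ) (t : ℝ) :
    laplace (iidSumLaw m n) t = laplace m t ^ n := by
  rw [laplace, iidSumLaw, integral_map (measurable_finSum n).aemeasurable (by fun_prop)]
  have : ∀ y : Fin n → ℝ, Real.exp (-(t * ∑ j, y j)) = ∏ j, Real.exp (-(t * y j)) := fun y => by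
    rw [← Real.exp_sum, Finset.mul_sum, Finset.sum_neg_distrib]
  simp only [this]
  rw [integral_fintype_prod_eq_prod (fun _ x => Real.exp (-(t * x)))]
  simp [laplace]

/-- The converse of `(1 - x / n) ^ n → exp (-x)`. -/
lemma tendsto_natCast_mul_one_sub_of_tendsto_pow {u : ℕ → ℝ} (hu0 : ∀ n, 0 < u n)
    (hu1 : ∀ n, u n ≤ 1) {ψ : ℝ} (h : Tendsto (fun n => u n ^ n) atTop (𝓝 (Real.exp (-ψ)))) :
    Tendsto (fun n : ℕ => n * (1 - u n)) atTop (𝓝 ψ) := by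
  -- With `y n = - log (u n)`, the claim is squeezed between `n * y n / (1 + y n)` and `n * y n`.
  set y : ℕ → ℝ := fun n => -Real.log (u n) with hy
  have hy0 n : 0 ≤ y n := by simpa [hy] using Real.log_nonpos (hu0 n).le (hu1 n)
  have huy n : u n = Real.exp (-y n) := by simp [hy, Real.exp_log (hu0 n)]
  have h1 : Tendsto (fun n : ℕ => n * y n) atTop (𝓝 ψ) := by
    have := ((Real.continuousAt_log (Real.exp_pos (-ψ)).ne').tendsto.comp h).neg
    simpa [Function.comp_def, Real.log_pow, hy] using this
  have h2 : Tendsto y atTop (𝓝 0) := by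
    have := h1.mul tendsto_inv_atTop_nhds_zero_nat
    rw [mul_zero] at this
    refine this.congr' ?_
    filter_upwards [eventually_gt_atTop 0] with n hn
    have : (n : ℝ) ≠ 0 := by positivity
    field_simp
  have h3 : Tendsto (fun n : ℕ => n * y n / (1 + y n)) atTop (𝓝 ψ) := by
    have := h1.div (h2.const_add 1) (by norm_num)
    rw [add_zero, div_one] at this
    exact this
  refine tendsto_of_tendsto_of_tendsto_of_le_of_le h3 h1 (fun n => ?_) fun n => ?_
  · have hp : 0 < 1 + y n := by linarith [hy0 n]
    have : u n ≤ (1 + y n)⁻¹ := by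
      rw [huy, Real.exp_neg]
      exact inv_anti₀ hp (by linarith [Real.add_one_le_exp (y n)])
    have e : (n : ℝ) * y n / (1 + y n) = n * (1 - (1 + y n)⁻¹) := by field_simp; ring
    simp only [e]
    gcongr
  · have : 1 - u n ≤ y n := by
      rw [huy]; linarith [Real.add_one_le_exp (-y n)]
    exact mul_le_mul_of_nonneg_left this n.cast_nonneg

/-- The bound behind both dominated convergence arguments; for `1 ≤ s` it is Bernoulli's
inequality. -/
lemma one_sub_exp_neg_mul_le {s x : ℝ} (hx : 0 ≤ x) :
    1 - Real.exp (-(s * x)) ≤ max 1 s * (1 - Real.exp (-x)) := by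
  have h0 : 0 ≤ 1 - Real.exp (-x) := by
    have : Real.exp (-x) ≤ 1 := Real.exp_le_one_iff.2 (by linarith)
    linarith
  rcases le_total s 1 with h | h
  · rw [max_eq_left h, one_mul]
    have : Real.exp (-x) ≤ Real.exp (-(s * x)) := Real.exp_le_exp.2 (by nlinarith)
    linarith
  · rw [max_eq_right h]
    have := one_add_mul_self_le_rpow_one_add (s := Real.exp (-x) - 1)
      (by linarith [Real.exp_pos (-x)]) h
    rw [add_sub_cancel, ← Real.exp_mul] at this
    have e : -x * s = -(s * x) := by ring
    rw [e] at this
    linarith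

lemma one_sub_laplace_le {m : Measure ℝ} [IsProbabilityMeasure m] (h : m (Set.Iio 0) = 0) {s : ℝ}
    (hs : 0 ≤ s) : 1 - laplace m s ≤ max 1 s * (1 - laplace m 1) := by
  have e {t : ℝ} (ht : 0 ≤ t) : 1 - laplace m t = ∫ x, (1 - Real.exp (-(t * x))) ∂m := by
    rw [integral_sub (integrable_const 1) (integrable_exp_neg_mul h ht)]
    simp [laplace]
  rw [e hs, e zero_le_one, ← integral_const_mul]
  refine integral_mono_ae ((integrable_const 1).sub (integrable_exp_neg_mul h hs))
    (((integrable_const 1).sub (integrable_exp_neg_mul h zero_le_one)).const_mul _) ?_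
  filter_upwards [ae_nonneg_of_null_neg h] with x hx
  simpa using one_sub_exp_neg_mul_le (s := s) hx

/-! ### Lévy measures -/

namespace IsLevyMeasure

variable {ρ : Measure ℝ} (hρ : IsLevyMeasure ρ)
include hρ

lemma ae_pos : ∀ᵐ w ∂ρ, 0 < w := by
  rw [ae_iff]; simpa [Set.Iic] using hρ.null_nonpos

/-- A Lévy measure has the strictly positive density `1 / min(1, x)` with respect to the finite
measure `min(1, x) ρ(dx)`. -/
lemma sFinite : SFinite ρ := by
  have : IsFiniteMeasure (ρ.withDensity fun x => ENNReal.ofReal (min 1 x)) :=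
    isFiniteMeasure_withDensity hρ.lintegral_min_lt_top.ne
  rw [← withDensity_inv_same₀ (μ := ρ) (f := fun x => ENNReal.ofReal (min 1 x)) (by fun_prop)
    (by filter_upwards [hρ.ae_pos] with x hx; simpa using hx) (by simp)]
  infer_instance

lemma integrable_min : Integrable (fun w => min 1 w) ρ := by
  refine ⟨by fun_prop, ?_⟩
  rw [hasFiniteIntegral_iff_ofReal (by
    filter_upwards [hρ.ae_pos] with x hx
    exact le_min zero_le_one hx.le)]
  exact hρ.lintegral_min_lt_top

lemma norm_one_sub_exp_le {t : ℝ} (ht : 0 ≤ t) :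
    ∀ᵐ w ∂ρ, ‖1 - Real.exp (-(w * t))‖ ≤ max 1 t * min 1 w := by
  filter_upwards [hρ.ae_pos] with w hw
  have h1 : Real.exp (-(w * t)) ≤ 1 := Real.exp_le_one_iff.2 (by nlinarith)
  rw [Real.norm_of_nonneg (by linarith), mul_comm w t]
  refine (one_sub_exp_neg_mul_le hw.le).trans (mul_le_mul_of_nonneg_left ?_ (by positivity))
  exact le_min (by linarith [Real.exp_pos (-w)]) (by linarith [Real.add_one_le_exp (-w)])

lemma integrable_one_sub_exp {t : ℝ} (ht : 0 ≤ t) :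
    Integrable (fun w => 1 - Real.exp (-(w * t))) ρ :=
  (hρ.integrable_min.const_mul (max 1 t)).mono' (by fun_prop) (hρ.norm_one_sub_exp_le ht)

end IsLevyMeasure

/-- The Laplace exponent `t a + ∫ (1 - exp (- w t)) ρ(dw)` of `ID(a, ρ)`. -/
noncomputable def laplaceExponent (a : ℝ) (ρ : Measure ℝ) (t : ℝ) : ℝ :=
  t * a + ∫ w, (1 - Real.exp (-(w * t))) ∂ρ

lemma IsIDLaw.laplace_eq {ν : Measure ℝ} {a : ℝ} {ρ : Measure ℝ} (h : IsIDLaw ν a ρ) {t : ℝ}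
    (ht : 0 ≤ t) : WideNet.laplace ν t = Real.exp (-laplaceExponent a ρ t) := by
  rw [WideNet.laplace, h.laplace t ht, laplaceExponent]; ring_nf

lemma tendsto_exp_neg_laplaceExponent (a : ℝ) {ρ : Measure ℝ} (hρ : IsLevyMeasure ρ) :
    Tendsto (fun t => Real.exp (-laplaceExponent a ρ t)) (𝓝[>] 0) (𝓝 1) := by
  have h1 : Tendsto (fun t : ℝ => ∫ w, (1 - Real.exp (-(w * t))) ∂ρ) (𝓝[>] 0)
      (𝓝 (∫ _, (0 : ℝ) ∂ρ)) := by
    refine tendsto_integral_filter_of_dominated_convergence (fun w => min 1 w)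
      (Eventually.of_forall fun t => by fun_prop) ?_ hρ.integrable_min ?_
    · have h01 : Set.Ioo (0 : ℝ) 1 ∈ 𝓝[>] (0 : ℝ) := Ioo_mem_nhdsGT one_pos
      filter_upwards [h01] with t ht
      simpa [max_eq_left ht.2.le] using hρ.norm_one_sub_exp_le ht.1.le
    · refine Eventually.of_forall fun w => tendsto_nhdsWithin_of_tendsto_nhds ?_
      have : Continuous fun t : ℝ => 1 - Real.exp (-(w * t)) := by fun_prop
      simpa using this.tendsto 0
  have h2 : Tendsto (fun t : ℝ => t * a) (𝓝[>] 0) (𝓝 0) := by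
    refine tendsto_nhdsWithin_of_tendsto_nhds ?_
    have : Continuous fun t : ℝ => t * a := by fun_prop
    simpa using this.tendsto 0
  have h3 := (h2.add h1).neg.rexp
  simpa [laplaceExponent] using h3

/-! ### Positive homogeneous functions -/

namespace PositiveHomogeneous

variable {φ : ℝ → ℝ} (hφ : PositiveHomogeneous φ)
include hφ

lemma map_zero : φ 0 = 0 := by
  have := hφ 2 0 (by norm_num)
  rw [mul_zero] at this; linarith

lemma eq_max : φ = fun z => φ 1 * max z 0 + φ (-1) * max (-z) 0 := by
  funext z
  rcases lt_trichotomy z 0 with h | rfl | h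
  · have := hφ (-z) (-1) (by linarith)
    rw [max_eq_right h.le, max_eq_left (by linarith)]
    simp only [mul_neg, mul_one, neg_neg] at this
    rw [this]; ring
  · simp [hφ.map_zero]
  · have := hφ z 1 h
    rw [max_eq_left h.le, max_eq_right (by linarith)]
    rw [mul_one] at this
    rw [this]; ring

lemma continuous : Continuous φ := by
  rw [hφ.eq_max]; fun_prop

lemma map_mul {γ : ℝ} (hγ : 0 ≤ γ) (z : ℝ) : φ (γ * z) = γ * φ z := by
  rcases hγ.eq_or_lt with rfl | h
  · simp [hφ.map_zero]
  · exact hφ γ z h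

lemma sq_le (z : ℝ) : φ z ^ 2 ≤ (φ 1 ^ 2 + φ (-1) ^ 2) * z ^ 2 := by
  rcases le_total 0 z with h | h
  · have := hφ.map_mul h 1
    rw [mul_one] at this
    rw [this]; nlinarith [sq_nonneg (z * φ (-1))]
  · have := hφ.map_mul (neg_nonneg.2 h) (-1)
    rw [mul_neg_one, neg_neg] at this
    rw [this]; nlinarith [sq_nonneg (z * φ 1)]

lemma integrable_sq : Integrable (fun z => φ z ^ 2) (gaussianReal 0 1) := by
  have h2 : Integrable (fun z : ℝ => z ^ 2) (gaussianReal 0 1) := by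
    simpa using (memLp_id_gaussianReal (μ := 0) (v := 1) 2).integrable_sq
  have := hφ.continuous
  refine (h2.const_mul (φ 1 ^ 2 + φ (-1) ^ 2)).mono' (by fun_prop) ?_
  exact Eventually.of_forall fun z => by
    rw [Real.norm_of_nonneg (sq_nonneg _)]; exact hφ.sq_le z

lemma integrable_sq_mul_pdf : Integrable (fun z => φ z ^ 2 * gaussianPDFReal 0 1 z) := by
  have h := hφ.integrable_sq
  rw [gaussianReal_of_var_ne_zero _ one_ne_zero,
    integrable_withDensity_iff_integrable_smul' (measurable_gaussianPDF 0 1)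
      (ae_of_all _ fun _ => gaussianPDF_lt_top)] at h
  simpa [toReal_gaussianPDF, mul_comm] using h

omit hφ in
lemma gaussianMeanSq_eq (φ : ℝ → ℝ) : gaussianMeanSq φ = ∫ z, φ z ^ 2 ∂(gaussianReal 0 1) := by
  rw [integral_gaussianReal_eq_integral_smul one_ne_zero, gaussianMeanSq]
  simp [mul_comm]

end PositiveHomogeneous

/-! ### The limiting Lévy measure -/

/-- The image of `ρ` under random rescaling by `φ(ζ)²` with `ζ` standard normal, without its
possible atom at zero. -/
noncomputable def activatedLevy (φ : ℝ → ℝ) (ρ : Measure ℝ) : Measure ℝ :=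
  (((gaussianReal 0 1).prod ρ).map fun q : ℝ × ℝ => q.2 * φ q.1 ^ 2).restrict (Set.Ioi 0)

section ActivatedLevy

variable {φ : ℝ → ℝ} (hφ : PositiveHomogeneous φ) {ρ : Measure ℝ} (hρ : IsLevyMeasure ρ)
include hφ

lemma measurable_activation : Measurable (fun q : ℝ × ℝ => q.2 * φ q.1 ^ 2) := by
  have := hφ.continuous; fun_prop

include hρ

lemma isLevyMeasure_activatedLevy : IsLevyMeasure (activatedLevy φ ρ) := by
  have := hρ.sFinite
  refine ⟨by rw [activatedLevy, Measure.restrict_apply measurableSet_Iic, Set.inter_comm,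
    Set.Ioi_inter_Iic, Set.Ioc_self, measure_empty], ?_⟩
  have hm := hφ.continuous.measurable
  calc ∫⁻ x, ENNReal.ofReal (min 1 x) ∂(activatedLevy φ ρ)
      ≤ ∫⁻ x, ENNReal.ofReal (min 1 x)
          ∂(((gaussianReal 0 1).prod ρ).map fun q : ℝ × ℝ => q.2 * φ q.1 ^ 2) :=
        lintegral_mono' Measure.restrict_le_self le_rfl
    _ = ∫⁻ q, ENNReal.ofReal (min 1 (q.2 * φ q.1 ^ 2)) ∂((gaussianReal 0 1).prod ρ) :=
        lintegral_map (by fun_prop) (measurable_activation hφ)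
    _ ≤ ∫⁻ q, ENNReal.ofReal (1 + φ q.1 ^ 2) * ENNReal.ofReal (min 1 q.2)
          ∂((gaussianReal 0 1).prod ρ) := by
        refine lintegral_mono fun q => ?_
        rw [← ENNReal.ofReal_mul (by positivity)]
        rcases le_total q.2 0 with h | h
        · rw [ENNReal.ofReal_of_nonpos]
          · exact zero_le
          · exact (min_le_right _ _).trans (mul_nonpos_of_nonpos_of_nonneg h (sq_nonneg _))
        · refine ENNReal.ofReal_le_ofReal ?_
          have hs := sq_nonneg (φ q.1)
          rcases le_total 1 q.2 with h' | h'
          · rw [min_eq_left h']; exact (min_le_left _ _).trans (by linarith)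
          · rw [min_eq_right h']; exact (min_le_right _ _).trans (by nlinarith)
    _ = (∫⁻ z, ENNReal.ofReal (1 + φ z ^ 2) ∂(gaussianReal 0 1)) *
          ∫⁻ w, ENNReal.ofReal (min 1 w) ∂ρ :=
        lintegral_prod_mul (f := fun z => ENNReal.ofReal (1 + φ z ^ 2))
          (g := fun w => ENNReal.ofReal (min 1 w)) (by fun_prop) (by fun_prop)
    _ < ∞ := by
        refine ENNReal.mul_lt_top ?_ hρ.lintegral_min_lt_top
        exact ((integrable_const (1 : ℝ)).add hφ.integrable_sq).lintegral_lt_top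

lemma activatedLevy_Ioi {x : ℝ} (hx : 0 < x) : activatedLevy φ ρ (Set.Ioi x) =
    ∫⁻ z in {z | φ z ≠ 0}, ρ (Set.Ioi (x / φ z ^ 2)) * gaussianPDF 0 1 z := by
  have := hρ.sFinite
  have hm := hφ.continuous.measurable
  have hset : MeasurableSet {z | φ z ≠ 0} := hm (measurableSet_singleton 0).compl
  rw [activatedLevy, Measure.restrict_apply measurableSet_Ioi,
    Set.inter_eq_left.2 (Set.Ioi_subset_Ioi hx.le),
    Measure.map_apply (measurable_activation hφ) measurableSet_Ioi,
    Measure.prod_apply (measurable_activation hφ measurableSet_Ioi),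
    gaussianReal_of_var_ne_zero _ one_ne_zero,
    lintegral_withDensity_eq_lintegral_mul _ (measurable_gaussianPDF 0 1)
      (measurable_measure_prodMk_left (measurable_activation hφ measurableSet_Ioi)),
    ← lintegral_indicator hset]
  refine lintegral_congr fun z => ?_
  by_cases hz : φ z = 0
  · have h0 : Prod.mk z ⁻¹' (fun q : ℝ × ℝ => q.2 * φ q.1 ^ 2) ⁻¹' Set.Ioi x = ∅ := by
      ext w; simp [hz, hx.le]
    simp [hz, h0]
  · have hz2 : 0 < φ z ^ 2 := by positivity
    rw [Set.indicator_of_mem (show z ∈ {z | φ z ≠ 0} from hz), Pi.mul_apply, mul_comm]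
    congr 2
    ext w
    simp [div_lt_iff₀ hz2]

lemma integral_laplaceExponent_mul_sq {a t : ℝ} (ht : 0 ≤ t) :
    ∫ z, laplaceExponent a ρ (t * φ z ^ 2) ∂(gaussianReal 0 1) =
      laplaceExponent (a * gaussianMeanSq φ) (activatedLevy φ ρ) t := by
  have := hρ.sFinite
  have hη := isLevyMeasure_activatedLevy hφ hρ
  have hmeas := measurable_activation hφ
  set η₀ := ((gaussianReal 0 1).prod ρ).map fun q : ℝ × ℝ => q.2 * φ q.1 ^ 2 with hη₀
  have hnn : ∀ᵐ u ∂η₀, u ∉ Set.Ioi (0 : ℝ) → 1 - Real.exp (-(u * t)) = 0 := by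
    rw [hη₀, ae_map_iff hmeas.aemeasurable (by
      refine MeasurableSet.imp measurableSet_Ioi.compl ?_
      exact measurableSet_eq_fun (by fun_prop) (by fun_prop))]
    have hw : ∀ᵐ q ∂((gaussianReal 0 1).prod ρ), 0 < q.2 :=
      Measure.quasiMeasurePreserving_snd.ae hρ.ae_pos
    filter_upwards [hw] with q hq hq'
    have h0 : q.2 * φ q.1 ^ 2 = 0 :=
      le_antisymm (by simpa using hq') (mul_nonneg hq.le (sq_nonneg _))
    simp [h0]
  have hi : Integrable (fun u => 1 - Real.exp (-(u * t))) η₀ :=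
    IntegrableOn.integrable_of_ae_notMem_eq_zero (hη.integrable_one_sub_exp ht) hnn
  have hi' : Integrable (fun q : ℝ × ℝ => 1 - Real.exp (-(q.2 * φ q.1 ^ 2 * t)))
      ((gaussianReal 0 1).prod ρ) :=
    (integrable_map_measure (by fun_prop) hmeas.aemeasurable).1 hi
  have e1 : ∫ u, (1 - Real.exp (-(u * t))) ∂(activatedLevy φ ρ) =
      ∫ z, ∫ w, (1 - Real.exp (-(w * (t * φ z ^ 2)))) ∂ρ ∂(gaussianReal 0 1) := by
    rw [activatedLevy, setIntegral_eq_integral_of_ae_compl_eq_zero hnn, hη₀,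
      integral_map hmeas.aemeasurable (by fun_prop), integral_prod _ hi']
    congr! 6
    ring
  have hi'' : Integrable (fun z => ∫ w, (1 - Real.exp (-(w * (t * φ z ^ 2)))) ∂ρ)
      (gaussianReal 0 1) := by
    convert hi'.integral_prod_left using 5
    ring_nf
  simp only [laplaceExponent]
  rw [integral_add ((hφ.integrable_sq.const_mul t).mul_const a) hi'', e1,
    PositiveHomogeneous.gaussianMeanSq_eq, integral_mul_const, integral_const_mul]
  ring

end ActivatedLevy

/-! ### Convergence of the layer multipliers -/

/-- The law of `λ φ(ζ)²` for independent `λ` with law `m` and standard normal `ζ`. -/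
noncomputable def activatedLaw (φ : ℝ → ℝ) (m : Measure ℝ) : Measure ℝ :=
  ((gaussianReal 0 1).prod m).map fun q : ℝ × ℝ => q.2 * φ q.1 ^ 2

lemma ConvergesInLaw.tendsto_laplace {ι : Type*} {F : Filter ι} [F.NeBot] {m : ι → Measure ℝ}
    {ν : Measure ℝ} (h : ConvergesInLaw m F ν) (h0 : ∀ n, m n (Set.Iio 0) = 0) {t : ℝ}
    (ht : 0 ≤ t) : Tendsto (fun n => laplace (m n) t) F (𝓝 (laplace ν t)) :=
  let ⟨hm, _, hlim⟩ := h
  (null_neg_and_tendsto_laplace (m := fun n => ⟨m n, hm n⟩) h0 hlim).2 t ht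

section Multipliers

variable {φ : ℝ → ℝ} (hφ : PositiveHomogeneous φ)
include hφ

lemma isProbabilityMeasure_activatedLaw (m : Measure ℝ) [IsProbabilityMeasure m] :
    IsProbabilityMeasure (activatedLaw φ m) :=
  Measure.isProbabilityMeasure_map (measurable_activation hφ).aemeasurable

lemma activatedLaw_null_neg {m : Measure ℝ} [IsProbabilityMeasure m] (h : m (Set.Iio 0) = 0) :
    activatedLaw φ m (Set.Iio 0) = 0 := by
  rw [activatedLaw, Measure.map_apply (measurable_activation hφ) measurableSet_Iio]
  have hw : ∀ᵐ q ∂((gaussianReal 0 1).prod m), 0 ≤ q.2 :=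
    Measure.quasiMeasurePreserving_snd.ae (ae_nonneg_of_null_neg h)
  refine measure_mono_null (t := {q : ℝ × ℝ | ¬ 0 ≤ q.2}) (fun q hq hq' => ?_) hw
  exact absurd (mul_nonneg hq' (sq_nonneg (φ q.1))) (not_le.2 hq)

lemma laplace_activatedLaw {m : Measure ℝ} [IsProbabilityMeasure m] (h : m (Set.Iio 0) = 0)
    {t : ℝ} (ht : 0 ≤ t) :
    Integrable (fun z => laplace m (t * φ z ^ 2)) (gaussianReal 0 1) ∧
      laplace (activatedLaw φ m) t = ∫ z, laplace m (t * φ z ^ 2) ∂(gaussianReal 0 1) := by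
  have := isProbabilityMeasure_activatedLaw hφ m
  have hi : Integrable (fun u => Real.exp (-(t * u))) (activatedLaw φ m) :=
    integrable_exp_neg_mul (activatedLaw_null_neg hφ h) ht
  have hi' : Integrable (fun q : ℝ × ℝ => Real.exp (-(t * (q.2 * φ q.1 ^ 2))))
      ((gaussianReal 0 1).prod m) :=
    (integrable_map_measure (by fun_prop) (measurable_activation hφ).aemeasurable).1 hi
  have e z : laplace m (t * φ z ^ 2) = ∫ w, Real.exp (-(t * (w * φ z ^ 2))) ∂m := by
    rw [laplace]; congr! 3; ring
  simp only [e]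
  refine ⟨hi'.integral_prod_left, ?_⟩
  rw [laplace, activatedLaw, integral_map (measurable_activation hφ).aemeasurable (by fun_prop),
    integral_prod _ hi']

/-- The Laplace transforms of the layer multipliers converge. The hypothesis on the sums of the
node variances gives `n (1 - E exp (-t λ)) → ψ t`, which is then averaged over the Gaussian
pre-activations by dominated convergence. -/
lemma tendsto_laplace_iidSumLaw_activatedLaw {m : ℕ → Measure ℝ} [∀ n, IsProbabilityMeasure (m n)]
    (h : ∀ n, m n (Set.Iio 0) = 0) {Λ : Measure ℝ} {a : ℝ} {ρ : Measure ℝ} (hΛ : IsIDLaw Λ a ρ)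
    (hconv : ConvergesInLaw (fun n => iidSumLaw (m n) n) atTop Λ) {t : ℝ} (ht : 0 ≤ t) :
    Tendsto (fun n => laplace (iidSumLaw (activatedLaw φ (m n)) n) t) atTop
      (𝓝 (Real.exp (-laplaceExponent (a * gaussianMeanSq φ) (activatedLevy φ ρ) t))) := by
  have hrate {s : ℝ} (hs : 0 ≤ s) :
      Tendsto (fun n : ℕ => n * (1 - laplace (m n) s)) atTop (𝓝 (laplaceExponent a ρ s)) := by
    refine tendsto_natCast_mul_one_sub_of_tendsto_pow (fun n => laplace_pos (h n) hs)
      (fun n => laplace_le_one (h n) hs) ?_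
    have := hconv.tendsto_laplace (fun n => iidSumLaw_null_neg (h n) n) hs
    simpa only [laplace_iidSumLaw, hΛ.laplace_eq hs] using this
  have hsq z : 0 ≤ t * φ z ^ 2 := by positivity
  have hDCT : Tendsto (fun n : ℕ => ∫ z, n * (1 - laplace (m n) (t * φ z ^ 2)) ∂(gaussianReal 0 1))
      atTop (𝓝 (∫ z, laplaceExponent a ρ (t * φ z ^ 2) ∂(gaussianReal 0 1))) := by
    refine tendsto_integral_filter_of_dominated_convergence
      (fun z => (1 + t * φ z ^ 2) * (laplaceExponent a ρ 1 + 1)) ?_ ?_ ?_ ?_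
    · exact Eventually.of_forall fun n =>
        (((integrable_const 1).sub (laplace_activatedLaw hφ (h n) ht).1).const_mul _).1
    -- The rate at `t φ(z)²` is at most `1 + t φ(z)²` times the rate at `1`, which is bounded.
    · filter_upwards [(hrate zero_le_one).eventually_le_const (lt_add_one _)] with n hn
      refine Eventually.of_forall fun z => ?_
      have h1 := laplace_le_one (h n) (hsq z)
      rw [Real.norm_of_nonneg (mul_nonneg n.cast_nonneg (by linarith))]
      have h2 := one_sub_laplace_le (h n) (hsq z)
      have h3 : max 1 (t * φ z ^ 2) ≤ 1 + t * φ z ^ 2 :=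
        max_le (by linarith [hsq z]) (by linarith)
      have h4 : 0 ≤ 1 - laplace (m n) 1 := by linarith [laplace_le_one (h n) zero_le_one]
      calc (n : ℝ) * (1 - laplace (m n) (t * φ z ^ 2))
          ≤ n * ((1 + t * φ z ^ 2) * (1 - laplace (m n) 1)) := by
            refine mul_le_mul_of_nonneg_left (h2.trans ?_) n.cast_nonneg
            exact mul_le_mul_of_nonneg_right h3 h4
        _ = (1 + t * φ z ^ 2) * (n * (1 - laplace (m n) 1)) := by ring
        _ ≤ _ := mul_le_mul_of_nonneg_left hn (by linarith [hsq z])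
    · exact ((integrable_const 1).add (hφ.integrable_sq.const_mul t)).mul_const _
    · exact Eventually.of_forall fun z => hrate (hsq z)
  rw [integral_laplaceExponent_mul_sq hφ hΛ.isLevyMeasure ht] at hDCT
  have hrate' : Tendsto (fun n : ℕ => n * (laplace (activatedLaw φ (m n)) t - 1)) atTop
      (𝓝 (-laplaceExponent (a * gaussianMeanSq φ) (activatedLevy φ ρ) t)) := by
    refine hDCT.neg.congr fun n => ?_
    obtain ⟨hi, he⟩ := laplace_activatedLaw hφ (h n) ht
    rw [he, integral_const_mul, integral_sub (integrable_const 1) hi]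
    simp; ring
  have := Real.tendsto_one_add_pow_exp_of_tendsto hrate'
  refine this.congr fun n => ?_
  have := isProbabilityMeasure_activatedLaw hφ (m n)
  rw [laplace_iidSumLaw]; ring_nf

lemma exists_isIDLaw_activatedLevy {m : ℕ → Measure ℝ} [∀ n, IsProbabilityMeasure (m n)]
    (h : ∀ n, m n (Set.Iio 0) = 0) {Λ : Measure ℝ} {a : ℝ} {ρ : Measure ℝ} (hΛ : IsIDLaw Λ a ρ)
    (hconv : ConvergesInLaw (fun n => iidSumLaw (m n) n) atTop Λ) :
    ∃ ν, IsIDLaw ν (a * gaussianMeanSq φ) (activatedLevy φ ρ) := by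
  have := fun n => isProbabilityMeasure_activatedLaw hφ (m n)
  have hη := isLevyMeasure_activatedLevy hφ hΛ.isLevyMeasure
  obtain ⟨ν, h1, h2, h3⟩ := exists_laplace_eq_of_tendsto
    (fun n => isProbabilityMeasure_iidSumLaw (activatedLaw φ (m n)) n)
    (fun n => iidSumLaw_null_neg (activatedLaw_null_neg hφ (h n)) n)
    (tendsto_exp_neg_laplaceExponent (a * gaussianMeanSq φ) hη)
    (fun t ht => tendsto_laplace_iidSumLaw_activatedLaw hφ h hΛ hconv ht)
  refine ⟨ν, h1, h2, mul_nonneg hΛ.location_nonneg ?_, hη, fun t ht => ?_⟩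
  · rw [PositiveHomogeneous.gaussianMeanSq_eq]
    exact integral_nonneg fun z => sq_nonneg _
  · rw [← laplace, h3 t ht, laplaceExponent]; ring_nf

lemma convergesInLaw_iidSumLaw_activatedLaw {m : ℕ → Measure ℝ} [∀ n, IsProbabilityMeasure (m n)]
    (h : ∀ n, m n (Set.Iio 0) = 0) {Λ : Measure ℝ} {a : ℝ} {ρ : Measure ℝ} (hΛ : IsIDLaw Λ a ρ)
    (hconv : ConvergesInLaw (fun n => iidSumLaw (m n) n) atTop Λ) {ν : Measure ℝ}
    (hν : IsIDLaw ν (a * gaussianMeanSq φ) (activatedLevy φ ρ)) :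
    ConvergesInLaw (fun n => iidSumLaw (activatedLaw φ (m n)) n) atTop ν := by
  have := fun n => isProbabilityMeasure_activatedLaw hφ (m n)
  exact convergesInLaw_of_laplace
    (fun n => isProbabilityMeasure_iidSumLaw (activatedLaw φ (m n)) n)
    (fun n => iidSumLaw_null_neg (activatedLaw_null_neg hφ (h n)) n)
    (tendsto_exp_neg_laplaceExponent (a * gaussianMeanSq φ) hν.isLevyMeasure)
    (fun t ht => tendsto_laplace_iidSumLaw_activatedLaw hφ h hΛ hconv ht)
    hν.isProbabilityMeasure hν.null_neg (fun t ht => hν.laplace_eq ht)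

end Multipliers

/-! ### Operations on convergence in law -/

section ConvergesInLaw

variable {ι κ E G : Type*} [MeasurableSpace E] [TopologicalSpace E] [OpensMeasurableSpace E]
  [MeasurableSpace G] [TopologicalSpace G]

lemma ConvergesInLaw.comp {μ : ι → Measure E} {F : Filter ι} {ν : Measure E}
    (h : ConvergesInLaw μ F ν) {f : κ → ι} {F' : Filter κ} (hf : Tendsto f F' F) :
    ConvergesInLaw (fun k => μ (f k)) F' ν :=
  let ⟨hμ, hν, hlim⟩ := h
  ⟨fun k => hμ (f k), hν, hlim.comp hf⟩

lemma ConvergesInLaw.congr {μ μ' : ι → Measure E} {F : Filter ι} {ν : Measure E}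
    (h : ConvergesInLaw μ F ν) (hμ' : ∀ i, IsProbabilityMeasure (μ' i))
    (he : ∀ᶠ i in F, μ i = μ' i) : ConvergesInLaw μ' F ν :=
  let ⟨_, hν, hlim⟩ := h
  ⟨hμ', hν, hlim.congr' (he.mono fun _ hi => Subtype.ext hi)⟩

lemma ConvergesInLaw.map [BorelSpace G] {μ : ι → Measure E} {F : Filter ι}
    {ν : Measure E} (h : ConvergesInLaw μ F ν) {f : E → G} (hf : Continuous f)
    (hfm : Measurable f) :
    ConvergesInLaw (fun i => (μ i).map f) F (ν.map f) :=
  let ⟨_, _, hlim⟩ := h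
  ⟨fun _ => Measure.isProbabilityMeasure_map hfm.aemeasurable,
    Measure.isProbabilityMeasure_map hfm.aemeasurable,
    ProbabilityMeasure.tendsto_map_of_tendsto_of_continuous _ _ hlim hf⟩

lemma ConvergesInLaw.prod [OpensMeasurableSpace G] [SecondCountableTopology E]
    [SecondCountableTopology G] [TopologicalSpace.PseudoMetrizableSpace E]
    [TopologicalSpace.PseudoMetrizableSpace G]
    {μ : ι → Measure E} {F : Filter ι} {ν : Measure E} (h : ConvergesInLaw μ F ν)
    {μ' : ι → Measure G} {ν' : Measure G} (h' : ConvergesInLaw μ' F ν') :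
    ConvergesInLaw (fun i => (μ i).prod (μ' i)) F (ν.prod ν') :=
  let ⟨_, hν, hlim⟩ := h
  let ⟨_, hν', hlim'⟩ := h'
  ⟨fun _ => inferInstance, inferInstance,
    (ProbabilityMeasure.continuous_prod.tendsto (⟨ν, hν⟩, ⟨ν', hν'⟩)).comp
      (hlim.prodMk_nhds hlim')⟩

lemma convergesInLaw_const (μ : Measure E) [hμ : IsProbabilityMeasure μ] (F : Filter ι) :
    ConvergesInLaw (fun _ => μ) F μ :=
  ⟨fun _ => hμ, hμ, tendsto_const_nhds⟩

end ConvergesInLaw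

/-! ### Gaussian vectors and mixtures -/

lemma integral_cexp_pi_gaussianReal {ι : Type*} [Fintype ι] (v : ι → ℝ≥0) (d : ι → ℝ) :
    ∫ x : ι → ℝ, Complex.exp ((∑ i, d i * x i : ℝ) * Complex.I)
        ∂(Measure.pi fun i => gaussianReal 0 (v i)) =
      Complex.exp (-(((∑ i, (v i : ℝ) * d i ^ 2 : ℝ) : ℂ) / 2)) := by
  have e (x : ι → ℝ) : Complex.exp ((∑ i, d i * x i : ℝ) * Complex.I) =
      ∏ i, Complex.exp (d i * x i * Complex.I) := by
    rw [← Complex.exp_sum, Complex.ofReal_sum, Finset.sum_mul]; simp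
  simp only [e]
  rw [integral_fintype_prod_eq_prod (fun i (x : ℝ) => Complex.exp (d i * x * Complex.I))]
  simp only [← charFun_apply_real, charFun_gaussianReal]
  rw [← Complex.exp_sum]
  congr 1
  push_cast
  rw [Finset.sum_div, ← Finset.sum_neg_distrib]
  exact Finset.sum_congr rfl fun i _ => by ring

/-- A linear image of a vector of independent centred Gaussians is again a vector of independent
centred Gaussians as soon as the quadratic forms of the variances agree; `d` is the adjoint of the
linear map `T`. -/
lemma map_pi_gaussianReal_eq {ι κ : Type*} [Fintype ι] [Fintype κ] (v : ι → ℝ≥0) (w : κ → ℝ≥0)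
    {T : (ι → ℝ) → κ → ℝ} (hT : Measurable T) {d : (κ → ℝ) → ι → ℝ}
    (hd : ∀ (c : κ → ℝ) (x : ι → ℝ), ∑ k, c k * T x k = ∑ i, d c i * x i)
    (hvar : ∀ c : κ → ℝ, ∑ i, (v i : ℝ) * d c i ^ 2 = ∑ k, (w k : ℝ) * c k ^ 2) :
    (Measure.pi fun i => gaussianReal 0 (v i)).map T =
      Measure.pi fun k => gaussianReal 0 (w k) := by
  classical
  have := Measure.isProbabilityMeasure_map (μ := Measure.pi fun i => gaussianReal 0 (v i))
    hT.aemeasurable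
  refine Measure.ext_of_charFunDual (funext fun F => ?_)
  obtain ⟨c, hF⟩ : ∃ c : κ → ℝ, ∀ y : κ → ℝ, F y = ∑ k, c k * y k :=
    ⟨fun k => F (Pi.single k 1), fun y => by
      conv_lhs => rw [pi_eq_sum_univ' y]
      simp [mul_comm]⟩
  rw [charFunDual_apply, charFunDual_apply, integral_map hT.aemeasurable (by fun_prop)]
  simp only [hF, hd]
  rw [integral_cexp_pi_gaussianReal, integral_cexp_pi_gaussianReal, hvar]

/-- The law of a vector of `m` independent standard normal variables. -/
noncomputable abbrev stdGaussianVec (m : ℕ) : Measure (Fin m → ℝ) :=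
  Measure.pi fun _ : Fin m => gaussianReal 0 1

/-- If, for every value of the mixing parameter, `F a` maps `Γ` to a product of centred Gaussians
with variance `V a`, then `F` maps the product measure to the Gaussian mixture. -/
lemma gaussianMixture_eq_map_prod {A B : Type*} [MeasurableSpace A] [MeasurableSpace B]
    (Q : Measure A) [SFinite Q] (Γ : Measure B) [SFinite Γ] {V : A → ℝ} {m : ℕ}
    {F : A × B → Fin m → ℝ} (hF : Measurable F)
    (h : ∀ a, Γ.map (fun b => F (a, b)) =
      Measure.pi fun _ : Fin m => gaussianReal 0 (V a).toNNReal) :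
    gaussianMixture Q V m = (Q.prod Γ).map F := by
  have hFa (a : A) : Measurable fun b => F (a, b) := hF.comp measurable_prodMk_left
  have key (s : Set (Fin m → ℝ)) (hs : MeasurableSet s) (a : A) :
      (Measure.pi fun _ : Fin m => gaussianReal 0 (V a).toNNReal) s =
        Γ (Prod.mk a ⁻¹' (F ⁻¹' s)) := by
    rw [← h a, Measure.map_apply (hFa a) hs]; rfl
  have hmeas : Measurable fun a => Measure.pi fun _ : Fin m => gaussianReal 0 (V a).toNNReal := by
    refine Measure.measurable_of_measurable_coe _ fun s hs => ?_
    simp only [key s hs]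
    exact measurable_measure_prodMk_left (hF hs)
  ext s hs
  rw [gaussianMixture, Measure.bind_apply hs hmeas.aemeasurable, Measure.map_apply hF hs,
    Measure.prod_apply (hF hs)]
  exact lintegral_congr fun a => key s hs a

/-- The vector `√v ζ`; for negative `v` it is zero, in accordance with the truncation of the
variance in `gaussianMixture`. -/
noncomputable def scaleVec (m : ℕ) (q : ℝ × (Fin m → ℝ)) : Fin m → ℝ := fun k => √q.1 * q.2 k

lemma continuous_scaleVec (m : ℕ) : Continuous (scaleVec m) := by
  unfold scaleVec; fun_prop

lemma map_scaleVec (m : ℕ) (v : ℝ) : (stdGaussianVec m).map (fun z => scaleVec m (v, z)) =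
    Measure.pi fun _ : Fin m => gaussianReal 0 v.toNNReal := by
  refine map_pi_gaussianReal_eq (ι := Fin m) (fun _ => 1) (fun _ => v.toNNReal)
    ((continuous_scaleVec m).comp (by fun_prop)).measurable (d := fun c k => c k * √v) ?_ ?_
  · intro c x
    exact Finset.sum_congr rfl fun k _ => by simp [scaleVec]; ring
  · intro c
    refine Finset.sum_congr rfl fun k _ => ?_
    rw [mul_pow, Real.coe_toNNReal', ← Real.sq_sqrt']
    simp; ring

lemma gaussianMixture_eq_map {A : Type*} [MeasurableSpace A] (Q : Measure A) [SFinite Q]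
    {V : A → ℝ} (hV : Measurable V) (m : ℕ) :
    gaussianMixture Q V m = ((Q.map V).prod (stdGaussianVec m)).map (scaleVec m) := by
  have hs := (continuous_scaleVec m).measurable
  rw [gaussianMixture_eq_map_prod Q (stdGaussianVec m)
    (F := fun q => scaleVec m (V q.1, q.2)) (hs.comp (by fun_prop)) (fun a => map_scaleVec m (V a))]
  have : (fun q : A × (Fin m → ℝ) => scaleVec m (V q.1, q.2)) =
    scaleVec m ∘ Prod.map V id := rfl
  rw [this, ← Measure.map_map hs (by fun_prop), ← Measure.map_prod_map _ _ hV measurable_id,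
    Measure.map_id]

lemma gaussianMixture_map_id {A : Type*} [MeasurableSpace A] (Q : Measure A) [SFinite Q]
    {V : A → ℝ} (hV : Measurable V) (m : ℕ) :
    gaussianMixture (Q.map V) id m = gaussianMixture Q V m := by
  rw [gaussianMixture_eq_map Q hV, gaussianMixture_eq_map _ measurable_id, Measure.map_id]

lemma isProbabilityMeasure_gaussianMixture (κ : Measure ℝ) [IsProbabilityMeasure κ] (m : ℕ) :
    IsProbabilityMeasure (gaussianMixture κ id m) := by
  rw [gaussianMixture_eq_map κ measurable_id, Measure.map_id]
  exact Measure.isProbabilityMeasure_map (continuous_scaleVec m).measurable.aemeasurable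

/-- Gaussian mixtures depend continuously on the law of the variance. -/
lemma ConvergesInLaw.gaussianMixture {ι : Type*} {F : Filter ι} {κ : ι → Measure ℝ} {κ' : Measure ℝ}
    (h : ConvergesInLaw κ F κ') (m : ℕ) :
    ConvergesInLaw (fun i => WideNet.gaussianMixture (κ i) id m) F
      (WideNet.gaussianMixture κ' id m) := by
  have hp := h.1
  have hp' := h.2.1
  have e (κ : Measure ℝ) [IsProbabilityMeasure κ] : WideNet.gaussianMixture κ id m =
      (κ.prod (stdGaussianVec m)).map (scaleVec m) := by
    rw [gaussianMixture_eq_map κ measurable_id, Measure.map_id]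
  simp only [e]
  exact (h.prod (convergesInLaw_const (stdGaussianVec m) F)).map (continuous_scaleVec m)
    (continuous_scaleVec m).measurable

/-- The coordinates of a vector picked out by an injection have the product law again. -/
lemma map_pi_comp_injective {ι κ : Type*} [Fintype ι] [Fintype κ] (μ : ι → Measure ℝ)
    [∀ i, IsProbabilityMeasure (μ i)] {f : κ → ι} (hf : f.Injective) :
    (Measure.pi μ).map (fun x k => x (f k)) = Measure.pi fun k => μ (f k) := by
  have h : iIndepFun (fun i (x : ι → ℝ) => x i) (Measure.pi μ) :=
    iIndepFun_pi (X := fun _ => id) fun _ => aemeasurable_id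
  have := (h.precomp hf).map_fun_eq_pi_map (fun k => (measurable_pi_apply _).aemeasurable)
  rw [this]
  congr! 2 with k
  exact (measurePreserving_eval μ (f k)).map_eq

lemma gaussianMixture_map_comp_injective (κ : Measure ℝ) [IsProbabilityMeasure κ] {m n : ℕ}
    {f : Fin m → Fin n} (hf : f.Injective) :
    (gaussianMixture κ id n).map (fun x k => x (f k)) = gaussianMixture κ id m := by
  have e : stdGaussianVec m = (stdGaussianVec n).map (fun x k => x (f k)) :=
    (map_pi_comp_injective (fun _ : Fin n => gaussianReal 0 1) hf).symm
  rw [gaussianMixture_eq_map κ measurable_id, gaussianMixture_eq_map κ measurable_id,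
    Measure.map_id, e, Measure.map_map (by fun_prop) (continuous_scaleVec n).measurable]
  conv_rhs => rw [← Measure.map_id (μ := κ)]
  rw [Measure.map_prod_map _ _ measurable_id (by fun_prop),
    Measure.map_map (continuous_scaleVec m).measurable (by fun_prop)]
  rfl

/-! ### One layer of the network -/

/-- The variances of the Gaussian parameters of one layer: the edges have variance `σv ^ 2` and the
biases `σb ^ 2`. -/
noncomputable def layerGaussVar (σb σv : ℝ≥0) (n n' : ℕ) : (Fin n × Fin n') ⊕ Fin n' → ℝ≥0 :=
  Sum.elim (fun _ => σv ^ 2) fun _ => σb ^ 2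

/-- The law of the Gaussian parameters of a layer with `n` inputs and `n'` outputs. -/
noncomputable abbrev layerGauss (σb σv : ℝ≥0) (n n' : ℕ) :
    Measure ((Fin n × Fin n') ⊕ Fin n' → ℝ) :=
  Measure.pi fun i => gaussianReal 0 (layerGaussVar σb σv n n' i)

/-- The outputs of a layer whose inputs have been multiplied by the weights `c`. -/
def layerOut {n n' : ℕ} (c : Fin n → ℝ) (g : (Fin n × Fin n') ⊕ Fin n' → ℝ) : Fin n' → ℝ :=
  fun k => ∑ j, c j * g (.inl (j, k)) + g (.inr k)

lemma map_layerOut (σb σv : ℝ≥0) {n n' : ℕ} (c : Fin n → ℝ) :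
    (layerGauss σb σv n n').map (layerOut c) = Measure.pi fun _ : Fin n' =>
      gaussianReal 0 ((σb : ℝ) ^ 2 + (σv : ℝ) ^ 2 * ∑ j, c j ^ 2).toNNReal := by
  refine map_pi_gaussianReal_eq _ (fun _ : Fin n' => _)
    (by unfold layerOut; fun_prop)
    (d := fun b => Sum.elim (fun q => c q.1 * b q.2) b) ?_ ?_
  · intro b x
    simp only [layerOut, Fintype.sum_sum_type, Sum.elim_inl, Sum.elim_inr, mul_add,
      Finset.sum_add_distrib, Fintype.sum_prod_type_right, Finset.mul_sum]
    congr! 3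
    ring
  · intro b
    have h0 : 0 ≤ ∑ j, c j ^ 2 := Finset.sum_nonneg fun j _ => sq_nonneg _
    simp only [layerGaussVar, Fintype.sum_sum_type, Sum.elim_inl, Sum.elim_inr,
      Fintype.sum_prod_type_right, Real.coe_toNNReal _ (show
        0 ≤ (σb : ℝ) ^ 2 + (σv : ℝ) ^ 2 * ∑ j, c j ^ 2 by positivity), NNReal.coe_pow,
      add_mul, Finset.sum_add_distrib]
    rw [add_comm]
    congr! 2 with k
    rw [Finset.mul_sum, Finset.sum_mul]
    exact Finset.sum_congr rfl fun j _ => by ring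

/-- Summing over a vector of node variances and an independent Gaussian vector is the same as
summing independent copies of `λ φ(ζ)²`. -/
lemma map_sum_mul_sq_prod {φ : ℝ → ℝ} (hφ : PositiveHomogeneous φ) (m : Measure ℝ)
    [IsProbabilityMeasure m] (n : ℕ) :
    ((stdGaussianVec n).prod (Measure.pi fun _ : Fin n => m)).map
      (fun q => ∑ j, q.2 j * φ (q.1 j) ^ 2) = iidSumLaw (activatedLaw φ m) n := by
  have hm := hφ.continuous.measurable
  have := isProbabilityMeasure_activatedLaw hφ m
  rw [iidSumLaw, activatedLaw, ← Measure.pi_map_pi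
      (fun _ => (measurable_activation hφ).aemeasurable),
    Measure.map_map (measurable_finSum n) (by fun_prop),
    ← (measurePreserving_arrowProdEquivProdArrow ℝ ℝ (Fin n) (fun _ => gaussianReal 0 1)
      (fun _ => m)).map_eq,
    Measure.map_map (by fun_prop) (MeasurableEquiv.measurable _)]
  rfl

/-- One layer transforms a Gaussian mixture with variance `v` into a Gaussian mixture with variance
`σb² + σv² T v`, where `T = ∑ λ_j φ(ζ_j)²` is independent of `v`: by positive homogeneity
`φ(√v ζ)² = v φ(ζ)²`. -/
lemma map_layerOut_gaussianMixture {φ : ℝ → ℝ} (hφ : PositiveHomogeneous φ) (σb σv : ℝ≥0)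
    (κ : Measure ℝ) [IsProbabilityMeasure κ] (hκ : κ (Set.Iio 0) = 0) (m : Measure ℝ)
    [IsProbabilityMeasure m] (hm : m (Set.Iio 0) = 0) (n n' : ℕ) :
    (((gaussianMixture κ id n).prod (Measure.pi fun _ : Fin n => m)).prod
        (layerGauss σb σv n n')).map
      (fun q => layerOut (fun j => √(q.1.2 j) * φ (q.1.1 j)) q.2) =
    gaussianMixture ((κ.prod (iidSumLaw (activatedLaw φ m) n)).map
      fun q => (σb : ℝ) ^ 2 + (σv : ℝ) ^ 2 * q.2 * q.1) id n' := by
  have hφm := hφ.continuous.measurable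
  have := isProbabilityMeasure_gaussianMixture κ n
  set V : (Fin n → ℝ) × (Fin n → ℝ) → ℝ := fun q =>
    (σb : ℝ) ^ 2 + (σv : ℝ) ^ 2 * ∑ j, (√(q.2 j) * φ (q.1 j)) ^ 2 with hV
  have hVm : Measurable V := by fun_prop
  rw [← gaussianMixture_eq_map_prod ((gaussianMixture κ id n).prod (Measure.pi fun _ : Fin n => m))
    (layerGauss σb σv n n') (V := V) (by unfold layerOut; fun_prop)
    (fun a => map_layerOut σb σv fun j => √(a.2 j) * φ (a.1 j)), ← gaussianMixture_map_id _ hVm]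
  congr 1
  rw [gaussianMixture_eq_map κ measurable_id, Measure.map_id]
  conv_lhs => rw [← Measure.map_id (μ := Measure.pi fun _ : Fin n => m)]
  rw [Measure.map_prod_map _ _ (continuous_scaleVec n).measurable measurable_id,
    Measure.map_map hVm (by have := (continuous_scaleVec n).measurable; fun_prop),
    ← map_sum_mul_sq_prod hφ m n]
  conv_rhs => rw [← Measure.map_id (μ := κ)]
  rw [Measure.map_prod_map _ _ measurable_id (by fun_prop),
    Measure.map_map (by fun_prop) (by fun_prop),
    ← (measurePreserving_prodAssoc κ (stdGaussianVec n) (Measure.pi fun _ : Fin n => m)).map_eq,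
    Measure.map_map (by fun_prop) (MeasurableEquiv.measurable _)]
  refine Measure.map_congr ?_
  have hv : ∀ᵐ q ∂((κ.prod (stdGaussianVec n)).prod (Measure.pi fun _ : Fin n => m)),
      0 ≤ q.1.1 :=
    (Measure.quasiMeasurePreserving_fst.comp Measure.quasiMeasurePreserving_fst).ae
      (ae_nonneg_of_null_neg hκ)
  have hl : ∀ᵐ q ∂((κ.prod (stdGaussianVec n)).prod (Measure.pi fun _ : Fin n => m)),
      ∀ j, 0 ≤ q.2 j :=
    ae_all_iff.2 fun j =>
      ((measurePreserving_eval (fun _ : Fin n => m) j).quasiMeasurePreserving.comp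
        Measure.quasiMeasurePreserving_snd).ae (ae_nonneg_of_null_neg hm)
  filter_upwards [hv, hl] with q hq hq'
  have e j : (√(q.2 j) * φ (√q.1.1 * q.1.2 j)) ^ 2 = q.2 j * φ (q.1.2 j) ^ 2 * q.1.1 := by
    rw [hφ.map_mul (Real.sqrt_nonneg _), mul_pow, mul_pow, Real.sq_sqrt (hq' j), Real.sq_sqrt hq]
    ring
  simp only [hV, Function.comp_apply, Prod.map, id, scaleVec, e, ← Finset.sum_mul]
  simp only [MeasurableEquiv.prodAssoc, MeasurableEquiv.coe_mk, Equiv.prodAssoc_apply]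
  ring

/-! ### The exact law of a finite network -/

/-- The law of the limiting (or of the finite-width) variance of layer `l + 1`, when the variance of
the first layer is `v₀` and the multipliers of the hidden layers are independent with laws `τ`. -/
noncomputable def varianceLaw (σb σv : ℝ≥0) {L : ℕ} (v₀ : ℝ) (τ : Fin L → Measure ℝ) :
    (l : ℕ) → l < L + 1 → Measure ℝ
  | 0, _ => Measure.dirac v₀
  | l + 1, h => ((varianceLaw σb σv v₀ τ l (Nat.lt_of_succ_lt h)).prod
      (τ ⟨l, Nat.lt_of_succ_lt_succ h⟩)).map fun q => (σb : ℝ) ^ 2 + (σv : ℝ) ^ 2 * q.2 * q.1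

section VarianceLaw

variable (σb σv : ℝ≥0) {L : ℕ}

lemma continuous_varianceStep :
    Continuous fun q : ℝ × ℝ => (σb : ℝ) ^ 2 + (σv : ℝ) ^ 2 * q.2 * q.1 := by
  fun_prop

lemma isProbabilityMeasure_varianceLaw (v₀ : ℝ) (τ : Fin L → Measure ℝ)
    [∀ l, IsProbabilityMeasure (τ l)] (l : ℕ) (h : l < L + 1) :
    IsProbabilityMeasure (varianceLaw σb σv v₀ τ l h) := by
  induction l with
  | zero => exact Measure.dirac.isProbabilityMeasure
  | succ l ih =>
    have := ih (Nat.lt_of_succ_lt h)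
    exact Measure.isProbabilityMeasure_map (continuous_varianceStep σb σv).measurable.aemeasurable

lemma varianceLaw_null_neg {v₀ : ℝ} (hv₀ : 0 ≤ v₀) {τ : Fin L → Measure ℝ}
    [∀ l, IsProbabilityMeasure (τ l)] (hτ : ∀ l, τ l (Set.Iio 0) = 0) (l : ℕ) (h : l < L + 1) :
    varianceLaw σb σv v₀ τ l h (Set.Iio 0) = 0 := by
  induction l with
  | zero => simpa [varianceLaw] using hv₀
  | succ l ih =>
    have ih' := ih (Nat.lt_of_succ_lt h)
    have := isProbabilityMeasure_varianceLaw σb σv v₀ τ l (Nat.lt_of_succ_lt h)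
    rw [varianceLaw, Measure.map_apply (continuous_varianceStep σb σv).measurable measurableSet_Iio]
    refine measure_mono_null (t := {q : ℝ × ℝ | ¬ (0 ≤ q.1 ∧ 0 ≤ q.2)}) (fun q hq hq' => ?_) ?_
    · have := mul_nonneg (mul_nonneg (sq_nonneg (σv : ℝ)) hq'.2) hq'.1
      have h2 : (σb : ℝ) ^ 2 + (σv : ℝ) ^ 2 * q.2 * q.1 < 0 := hq
      linarith [sq_nonneg (σb : ℝ)]
    · have h1 := Measure.quasiMeasurePreserving_fst (μ := varianceLaw σb σv v₀ τ l
        (Nat.lt_of_succ_lt h)) (ν := τ ⟨l, Nat.lt_of_succ_lt_succ h⟩) |>.ae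
        (ae_nonneg_of_null_neg ih')
      have h2 := Measure.quasiMeasurePreserving_snd (μ := varianceLaw σb σv v₀ τ l
        (Nat.lt_of_succ_lt h)) (ν := τ ⟨l, Nat.lt_of_succ_lt_succ h⟩) |>.ae
        (ae_nonneg_of_null_neg (hτ ⟨l, Nat.lt_of_succ_lt_succ h⟩))
      exact h1.and h2

lemma convergesInLaw_varianceLaw {ι : Type*} {F : Filter ι} (v₀ : ℝ) {τ : ι → Fin L → Measure ℝ}
    {τ' : Fin L → Measure ℝ} (hτ : ∀ l, ConvergesInLaw (fun i => τ i l) F (τ' l)) (l : ℕ)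
    (h : l < L + 1) :
    ConvergesInLaw (fun i => varianceLaw σb σv v₀ (τ i) l h) F (varianceLaw σb σv v₀ τ' l h) := by
  induction l with
  | zero => exact convergesInLaw_const (Measure.dirac v₀) _
  | succ l ih =>
    have hc := continuous_varianceStep σb σv
    exact ((ih (Nat.lt_of_succ_lt h)).prod (hτ ⟨l, Nat.lt_of_succ_lt_succ h⟩)).map hc hc.measurable

end VarianceLaw

namespace ParamIdx

variable {din dout L : ℕ} {p : Fin L → ℕ+}

noncomputable instance : Fintype (ParamIdx din dout p) := by
  classical
  let f : ((Σ l : Fin L, Fin (layerWidth din dout p (l + 1))) ⊕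
      ((Σ l : Fin (L + 1), Fin (layerWidth din dout p l) × Fin (layerWidth din dout p (l + 1))) ⊕
        Σ l : Fin (L + 1), Fin (layerWidth din dout p (l + 1)))) → ParamIdx din dout p :=
    Sum.elim (fun q => .nodeVar q.1 q.2)
      (Sum.elim (fun q => .gauss q.1 q.2.1 q.2.2) fun q => .bias q.1 q.2)
  refine Fintype.ofSurjective f fun i => ?_
  match i with
  | .nodeVar l j => exact ⟨.inl ⟨l, j⟩, rfl⟩
  | .gauss l j k => exact ⟨.inr (.inl ⟨l, j, k⟩), rfl⟩
  | .bias l k => exact ⟨.inr (.inr ⟨l, k⟩), rfl⟩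

/-- The index `l` of the first pre-activation `preact _ _ _ l` that involves the given parameter. -/
def depth : ParamIdx din dout p → ℕ
  | .nodeVar l _ => l + 1
  | .gauss l _ _ => l
  | .bias l _ => l

/-- The names of the node variances of hidden layer `l + 1`. -/
def nodeVarIdx (l : Fin L) (j : Fin (layerWidth din dout p (l + 1))) : ParamIdx din dout p :=
  .nodeVar l j

/-- The names of the edge variables and biases that feed layer `l + 1`. -/
def gaussIdx (l : ℕ) (h : l < L + 1) :
    (Fin (layerWidth din dout p l) × Fin (layerWidth din dout p (l + 1))) ⊕
      Fin (layerWidth din dout p (l + 1)) → ParamIdx din dout p :=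
  Sum.elim (fun q => .gauss ⟨l, h⟩ q.1 q.2) fun k => .bias ⟨l, h⟩ k

lemma nodeVarIdx_injective (l : Fin L) :
    (nodeVarIdx l : _ → ParamIdx din dout p).Injective := by
  intro j k h
  simpa [nodeVarIdx] using h

lemma gaussIdx_injective (l : ℕ) (h : l < L + 1) :
    (gaussIdx l h : _ → ParamIdx din dout p).Injective := by
  rintro (⟨j, k⟩ | k) (⟨j', k'⟩ | k') h
  · have := ParamIdx.gauss.inj h
    simp_all
  · cases h
  · cases h
  · have := ParamIdx.bias.inj h
    simp_all

/-- The laws of the parameters of a random network. -/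
noncomputable def law (σb σv : ℝ≥0) (μ : Fin L → ℕ+ → Measure ℝ) :
    ParamIdx din dout p → Measure ℝ
  | .nodeVar l _ => μ l (p l)
  | .gauss _ _ _ => gaussianReal 0 (σv ^ 2)
  | .bias _ _ => gaussianReal 0 (σb ^ 2)

instance (σb σv : ℝ≥0) (μ : Fin L → ℕ+ → Measure ℝ) [∀ l n, IsProbabilityMeasure (μ l n)]
    (i : ParamIdx din dout p) : IsProbabilityMeasure (law σb σv μ i) := by
  cases i <;> (unfold law; infer_instance)

end ParamIdx

/-- Functions of an independent family that depend on disjoint sets of coordinates are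
independent. -/
lemma indepFun_of_dependsOn {Ω ι E G : Type*} [MeasurableSpace Ω] {P : Measure Ω} [Fintype ι]
    [MeasurableSpace E] [MeasurableSpace G] {X : ι → Ω → ℝ} (h : iIndepFun X P)
    (hX : ∀ i, Measurable (X i)) {S T : Set ι} (hST : Disjoint S T)
    {f : (ι → ℝ) → E} (hf : Measurable f) (hfS : DependsOn f S)
    {g : (ι → ℝ) → G} (hg : Measurable g) (hgT : DependsOn g T) :
    IndepFun (fun ω => f fun i => X i ω) (fun ω => g fun i => X i ω) P := by
  classical
  have h2 := h.indepFun_finset S.toFinset T.toFinset (by simpa using hST) hX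
  let ext (U : Finset ι) (r : U → ℝ) : ι → ℝ := fun i => if h : i ∈ U then r ⟨i, h⟩ else 0
  have hext U : Measurable (ext U) := by
    refine measurable_pi_iff.2 fun i => ?_
    by_cases h : i ∈ U
    · simp only [ext, h, dite_true]; exact measurable_pi_apply _
    · simp only [ext, h, dite_false]; exact measurable_const
  have ef : (fun ω => f fun i => X i ω) =
      (f ∘ ext S.toFinset) ∘ fun ω (i : S.toFinset) => X i ω :=
    funext fun x => hfS fun i hi => by simp [ext, hi]
  have eg : (fun ω => g fun i => X i ω) =
      (g ∘ ext T.toFinset) ∘ fun ω (i : T.toFinset) => X i ω :=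
    funext fun x => hgT fun i hi => by simp [ext, hi]
  rw [ef, eg]
  exact h2.comp (hf.comp (hext _)) (hg.comp (hext _))

lemma indepFun_pi_of_dependsOn {ι E G : Type*} [Fintype ι] [MeasurableSpace E] [MeasurableSpace G]
    (ν : ι → Measure ℝ) [∀ i, IsProbabilityMeasure (ν i)] {S T : Set ι} (hST : Disjoint S T)
    {f : (ι → ℝ) → E} (hf : Measurable f) (hfS : DependsOn f S)
    {g : (ι → ℝ) → G} (hg : Measurable g) (hgT : DependsOn g T) :
    IndepFun f g (Measure.pi ν) :=
  indepFun_of_dependsOn (X := fun i (x : ι → ℝ) => x i)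
    (iIndepFun_pi (X := fun _ => id) fun _ => aemeasurable_id) measurable_pi_apply hST hf hfS hg hgT

section Network

variable {din dout L : ℕ} {p : Fin L → ℕ+} {φ : ℝ → ℝ} (x : EuclideanSpace ℝ (Fin din))

lemma preact_zero (θ : ParamIdx din dout p → ℝ) (h : 0 < L + 1) :
    preact φ x θ 0 h =
      layerOut (n := din) (fun j => √(1 / (din : ℝ)) * x j)
        (fun i => θ (ParamIdx.gaussIdx 0 h i)) := by
  funext k
  simp only [preact, layerOut, weight, nodeVariance, ParamIdx.gaussIdx]
  congr 1
  exact Finset.sum_congr rfl fun j _ => mul_right_comm _ _ _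

lemma preact_succ (θ : ParamIdx din dout p → ℝ) (l : ℕ) (h : l + 1 < L + 1) :
    preact φ x θ (l + 1) h = layerOut
      (fun j => √(θ (ParamIdx.nodeVarIdx ⟨l, Nat.lt_of_succ_lt_succ h⟩ j)) *
        φ (preact φ x θ l (Nat.lt_of_succ_lt h) j))
      (fun i => θ (ParamIdx.gaussIdx (l + 1) h i)) := by
  funext k
  simp only [preact, layerOut, weight, nodeVariance, ParamIdx.gaussIdx, ParamIdx.nodeVarIdx,
    Sum.elim_inl, Sum.elim_inr]
  congr 1
  exact Finset.sum_congr rfl fun j _ => by ring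

lemma measurable_layerOut {n n' : ℕ} {A : Type*} [MeasurableSpace A] {c : A → Fin n → ℝ}
    (hc : Measurable c) {g : A → (Fin n × Fin n') ⊕ Fin n' → ℝ} (hg : Measurable g) :
    Measurable fun a => layerOut (c a) (g a) := by
  unfold layerOut; fun_prop

lemma measurable_preact (hφ : PositiveHomogeneous φ) (l : ℕ) (h : l < L + 1) :
    Measurable fun θ : ParamIdx din dout p → ℝ => preact φ x θ l h := by
  have hm := hφ.continuous.measurable
  induction l with
  | zero =>
    simp only [preact_zero]
    exact measurable_layerOut measurable_const (by fun_prop)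
  | succ l ih =>
    have := ih (Nat.lt_of_succ_lt h)
    simp only [preact_succ]
    exact measurable_layerOut (by fun_prop) (by fun_prop)

lemma ParamIdx.depth_gaussIdx (l : ℕ) (h : l < L + 1) (i) :
    (ParamIdx.gaussIdx l h i : ParamIdx din dout p).depth = l := by
  rcases i with i | i <;> rfl

lemma dependsOn_preact (l : ℕ) (h : l < L + 1) :
    DependsOn (fun θ : ParamIdx din dout p → ℝ => preact φ x θ l h) {i | i.depth ≤ l} := by
  induction l with
  | zero =>
    intro θ θ' hθ
    simp only [preact_zero]
    congr 1
    exact funext fun i => hθ _ (ParamIdx.depth_gaussIdx 0 h i).le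
  | succ l ih =>
    intro θ θ' hθ
    have h1 : preact φ x θ l (Nat.lt_of_succ_lt h) = preact φ x θ' l (Nat.lt_of_succ_lt h) :=
      ih (Nat.lt_of_succ_lt h) fun i hi => hθ i (Nat.le_succ_of_le hi)
    simp only [preact_succ, h1]
    congr 1
    · funext j
      rw [hθ _ (le_refl (l + 1))]
    · exact funext fun i => hθ _ (ParamIdx.depth_gaussIdx (l + 1) h i).le

/-- The variance of the first layer. -/
noncomputable def inputVariance (σb σv : ℝ≥0) {din : ℕ} (x : EuclideanSpace ℝ (Fin din)) : ℝ :=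
  (σb : ℝ) ^ 2 + (σv : ℝ) ^ 2 * ‖x‖ ^ 2 / din

/-- The laws of the multipliers `∑ λ_j φ(ζ_j)²` of the hidden layers in a network of widths `p`. -/
noncomputable def multiplierLaw (φ : ℝ → ℝ) (μ : Fin L → ℕ+ → Measure ℝ) (p : Fin L → ℕ+)
    (l : Fin L) : Measure ℝ :=
  iidSumLaw (activatedLaw φ (μ l (p l))) (p l)

lemma isProbabilityMeasure_multiplierLaw (hφ : PositiveHomogeneous φ)
    (μ : Fin L → ℕ+ → Measure ℝ) [∀ l n, IsProbabilityMeasure (μ l n)] (p : Fin L → ℕ+)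
    (l : Fin L) : IsProbabilityMeasure (multiplierLaw φ μ p l) := by
  have := isProbabilityMeasure_activatedLaw hφ (μ l (p l))
  exact isProbabilityMeasure_iidSumLaw _ _

variable (σb σv : ℝ≥0) (μ : Fin L → ℕ+ → Measure ℝ) [∀ l n, IsProbabilityMeasure (μ l n)]

lemma map_gaussIdx (l : ℕ) (h : l < L + 1) :
    (Measure.pi (ParamIdx.law σb σv μ : ParamIdx din dout p → Measure ℝ)).map
      (fun θ i => θ (ParamIdx.gaussIdx l h i)) = layerGauss σb σv _ _ := by
  rw [map_pi_comp_injective _ (ParamIdx.gaussIdx_injective l h)]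
  congr 1
  funext i
  rcases i with i | i <;> rfl

/-- At every finite width, the pre-activations of a layer are an exact Gaussian mixture. -/
lemma map_preact (hφ : PositiveHomogeneous φ) (hμ : ∀ l n, μ l n (Set.Iio 0) = 0)
    (l : ℕ) (h : l < L + 1) :
    (Measure.pi (ParamIdx.law σb σv μ : ParamIdx din dout p → Measure ℝ)).map
        (fun θ => preact φ x θ l h) =
      gaussianMixture (varianceLaw σb σv (inputVariance σb σv x) (multiplierLaw φ μ p) l h) id
        (layerWidth din dout p (l + 1)) := by
  have hτ := isProbabilityMeasure_multiplierLaw hφ μ p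
  have hτ0 l : multiplierLaw φ μ p l (Set.Iio 0) = 0 := by
    have := isProbabilityMeasure_activatedLaw hφ (μ l (p l))
    exact iidSumLaw_null_neg (activatedLaw_null_neg hφ (hμ _ _)) _
  have hv₀ : 0 ≤ inputVariance σb σv x := by unfold inputVariance; positivity
  set M := Measure.pi (ParamIdx.law σb σv μ : ParamIdx din dout p → Measure ℝ)
  have hφm := hφ.continuous.measurable
  induction l with
  | zero =>
    simp only [preact_zero]
    have hmeas : Measurable (layerOut (n := din) (n' := layerWidth din dout p 1)
      (fun j => √(1 / (din : ℝ)) * x j)) := measurable_layerOut measurable_const measurable_id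
    have e := Measure.map_map (μ := M) hmeas
      (f := fun θ i => θ (ParamIdx.gaussIdx 0 h i)) (by fun_prop)
    have e0 : M.map (fun θ i => θ (ParamIdx.gaussIdx 0 h i)) = layerGauss σb σv din _ :=
      map_gaussIdx σb σv μ 0 h
    refine e.symm.trans ((congrArg _ e0).trans ((map_layerOut σb σv _).trans ?_))
    rw [varianceLaw, gaussianMixture_eq_map _ measurable_id, Measure.map_id, Measure.dirac_prod,
      Measure.map_map (continuous_scaleVec _).measurable (by fun_prop)]
    refine Eq.trans ?_ (map_scaleVec _ _).symm
    congr 3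
    simp only [mul_pow, ← Finset.mul_sum, Real.sq_sqrt (show 0 ≤ 1 / (din : ℝ) by positivity),
      inputVariance, EuclideanSpace.real_norm_sq_eq]
    ring_nf
  | succ l ih =>
    have hl := Nat.lt_of_succ_lt h
    have ih := ih hl
    have hZ := measurable_preact (p := p) (dout := dout) x hφ l hl
    set κ := varianceLaw σb σv (inputVariance σb σv x) (multiplierLaw φ μ p) l hl
    have := isProbabilityMeasure_varianceLaw σb σv (inputVariance σb σv x)
      (multiplierLaw φ μ p) l hl
    have hκ0 := varianceLaw_null_neg σb σv hv₀ hτ0 l hl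
    let l' : Fin L := ⟨l, Nat.lt_of_succ_lt_succ h⟩
    -- The pre-activations `Z` of the layer below, its node variances `lam` and the Gaussian
    -- parameters `G` of the new layer involve disjoint sets of parameters.
    let Z : (ParamIdx din dout p → ℝ) → Fin (layerWidth din dout p (l + 1)) → ℝ :=
      fun θ => preact φ x θ l hl
    let lam : (ParamIdx din dout p → ℝ) → Fin (layerWidth din dout p (l + 1)) → ℝ :=
      fun θ j => θ (ParamIdx.nodeVarIdx l' j)
    let G : (ParamIdx din dout p → ℝ) → _ := fun θ i => θ (ParamIdx.gaussIdx (l + 1) h i)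
    have hlam : Measurable lam := by fun_prop
    have hG : Measurable G := by fun_prop
    have hlamS : DependsOn lam (Set.range (ParamIdx.nodeVarIdx l')) :=
      fun θ θ' hθ => funext fun j => hθ _ ⟨j, rfl⟩
    have hGS : DependsOn G (Set.range (ParamIdx.gaussIdx (l + 1) h)) :=
      fun θ θ' hθ => funext fun j => hθ _ ⟨j, rfl⟩
    have hZS : DependsOn Z {i | i.depth ≤ l} := dependsOn_preact x l hl
    have hd1 : Disjoint {i : ParamIdx din dout p | i.depth ≤ l}
        (Set.range (ParamIdx.nodeVarIdx l')) := by
      rw [Set.disjoint_left]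
      rintro _ hi ⟨j, rfl⟩
      have : l + 1 ≤ l := hi
      omega
    have hd2 : Disjoint ({i : ParamIdx din dout p | i.depth ≤ l} ∪
        Set.range (ParamIdx.nodeVarIdx l')) (Set.range (ParamIdx.gaussIdx (l + 1) h)) := by
      rw [Set.disjoint_right]
      rintro _ ⟨j, rfl⟩ (hi | ⟨k, hk⟩)
      · have : (ParamIdx.gaussIdx (l + 1) h j).depth ≤ l := hi
        rw [ParamIdx.depth_gaussIdx] at this
        omega
      · rcases j with j | j <;> cases hk
    have hind1 : M.map (fun θ => (Z θ, lam θ)) = (M.map Z).prod (M.map lam) :=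
      (indepFun_iff_map_prod_eq_prod_map_map hZ.aemeasurable hlam.aemeasurable).1
        (indepFun_pi_of_dependsOn _ hd1 hZ hZS hlam hlamS)
    have hind2 : M.map (fun θ => ((Z θ, lam θ), G θ)) =
        (M.map fun θ => (Z θ, lam θ)).prod (M.map G) := by
      refine (indepFun_iff_map_prod_eq_prod_map_map (hZ.prodMk hlam).aemeasurable
        hG.aemeasurable).1 (indepFun_pi_of_dependsOn _ hd2 (hZ.prodMk hlam) ?_ hG hGS)
      intro θ θ' hθ
      exact Prod.ext (hZS fun i hi => hθ i (Or.inl hi)) (hlamS fun i hi => hθ i (Or.inr hi))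
    have elam : M.map lam = Measure.pi fun _ => μ l' (p l') :=
      map_pi_comp_injective _ (ParamIdx.nodeVarIdx_injective l')
    have eG : M.map G = layerGauss σb σv _ _ := map_gaussIdx σb σv μ (l + 1) h
    have eZ : M.map Z = gaussianMixture κ id (layerWidth din dout p (l + 1)) := ih
    have step := map_layerOut_gaussianMixture hφ σb σv κ hκ0 (μ l' (p l')) (hμ _ _)
      (layerWidth din dout p (l + 1)) (layerWidth din dout p (l + 1 + 1))
    rw [← eZ, ← elam, ← eG, ← hind1, ← hind2, Measure.map_map
      (measurable_layerOut (by fun_prop) (by fun_prop)) ((hZ.prodMk hlam).prodMk hG)] at step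
    simp only [preact_succ]
    refine Eq.trans step ?_
    have hw : layerWidth din dout p (l + 1) = p l' := by
      simp [layerWidth, l', Nat.lt_of_succ_lt_succ h]
    rw [varianceLaw]
    congr 3
    rw [multiplierLaw]
    congr 1

/-- The first pre-activations of a sufficiently wide layer of a finite network. -/
lemma map_firstPreacts (hφ : PositiveHomogeneous φ) (hμ : ∀ l n, μ l n (Set.Iio 0) = 0)
    (l : Fin (L + 1)) {m : ℕ} (hm : m ≤ layerWidth din dout p (l + 1)) :
    (Measure.pi (ParamIdx.law σb σv μ : ParamIdx din dout p → Measure ℝ)).map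
        (firstPreacts φ x l m) =
      gaussianMixture (varianceLaw σb σv (inputVariance σb σv x) (multiplierLaw φ μ p) l l.isLt)
        id m := by
  have hτ := isProbabilityMeasure_multiplierLaw hφ μ p
  have := isProbabilityMeasure_varianceLaw σb σv (inputVariance σb σv x)
    (multiplierLaw φ μ p) l l.isLt
  rw [← gaussianMixture_map_comp_injective _ (Fin.castLE_injective hm),
    ← map_preact x σb σv μ hφ hμ l l.isLt,
    Measure.map_map (by fun_prop) (measurable_preact x hφ l l.isLt)]
  congr 1
  funext θ k
  have hk : (k : ℕ) < layerWidth din dout p (l + 1) := k.isLt.trans_le hm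
  simp only [firstPreacts, hk, dite_true, Function.comp_apply]
  rfl

lemma measurable_firstPreacts (hφ : PositiveHomogeneous φ) (l : Fin (L + 1)) (m : ℕ) :
    Measurable (firstPreacts φ x l m : (ParamIdx din dout p → ℝ) → Fin m → ℝ) := by
  refine measurable_pi_iff.2 fun k => ?_
  by_cases hk : (k : ℕ) < layerWidth din dout p (l + 1)
  · simp only [firstPreacts, hk, dite_true]
    exact (measurable_pi_apply _).comp (measurable_preact x hφ l l.isLt)
  · simp only [firstPreacts, hk, dite_false]
    exact measurable_const

omit [∀ l n, IsProbabilityMeasure (μ l n)] in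
lemma IsRandomNetwork.hasLaw {Ω : Type*} [MeasurableSpace Ω] {P : Measure Ω}
    {θ : ParamIdx din dout p → Ω → ℝ} (hθ : IsRandomNetwork p σb σv μ P θ)
    (i : ParamIdx din dout p) : HasLaw (θ i) (ParamIdx.law σb σv μ i) P := by
  cases i with
  | nodeVar l j => exact hθ.law_nodeVar l j
  | gauss l j k => exact hθ.law_gauss l j k
  | bias l k => exact hθ.law_bias l k

end Network

/-! ### The limiting variances -/

section LimitVariance

variable {din L : ℕ} (σb σv : ℝ≥0) (x : EuclideanSpace ℝ (Fin din))

lemma measurable_limitVariance (l : ℕ) (h : l < L + 1) :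
    Measurable fun s : Fin L → ℝ => limitVariance σb σv x s l h := by
  induction l with
  | zero => exact measurable_const
  | succ l ih =>
    have := ih (Nat.lt_of_succ_lt h)
    simp only [limitVariance]
    fun_prop

lemma dependsOn_limitVariance (l : ℕ) (h : l < L + 1) :
    DependsOn (fun s : Fin L → ℝ => limitVariance σb σv x s l h) {i | (i : ℕ) < l} := by
  induction l with
  | zero => exact fun s s' _ => rfl
  | succ l ih =>
    intro s s' hs
    have h1 : limitVariance σb σv x s l (Nat.lt_of_succ_lt h) =
        limitVariance σb σv x s' l (Nat.lt_of_succ_lt h) :=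
      ih (Nat.lt_of_succ_lt h) fun i hi => hs i (Nat.lt_succ_of_lt hi)
    simp only [limitVariance, h1]
    rw [hs ⟨l, Nat.lt_of_succ_lt_succ h⟩ (Nat.lt_succ_self l)]

lemma limitVariance_nonneg {s : Fin L → ℝ} (hs : ∀ i, 0 ≤ s i) (l : ℕ) (h : l < L + 1) :
    0 ≤ limitVariance σb σv x s l h := by
  induction l with
  | zero => simp only [limitVariance]; positivity
  | succ l ih =>
    have := ih (Nat.lt_of_succ_lt h)
    have := hs ⟨l, Nat.lt_of_succ_lt_succ h⟩
    simp only [limitVariance]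
    positivity

variable {Ω : Type*} [MeasurableSpace Ω] {Q : Measure Ω} [IsProbabilityMeasure Q]
  {S : Fin L → Ω → ℝ} (hS : ∀ l, Measurable (S l)) (hind : iIndepFun S Q)

include hS

lemma measurable_limitVariance_comp (l : ℕ) (h : l < L + 1) :
    Measurable fun ω => limitVariance σb σv x (fun i => S i ω) l h :=
  (measurable_limitVariance σb σv x l h).comp (measurable_pi_iff.2 hS)

include hind

lemma map_limitVariance (l : ℕ) (h : l < L + 1) :
    Q.map (fun ω => limitVariance σb σv x (fun i => S i ω) l h) =
      varianceLaw σb σv (inputVariance σb σv x) (fun i => Q.map (S i)) l h := by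
  induction l with
  | zero => simp [limitVariance, varianceLaw, inputVariance]
  | succ l ih =>
    have hl := Nat.lt_of_succ_lt h
    have hV := measurable_limitVariance_comp σb σv x hS l hl
    let l' : Fin L := ⟨l, Nat.lt_of_succ_lt_succ h⟩
    have hi : IndepFun (fun ω => limitVariance σb σv x (fun i => S i ω) l hl) (S l') Q := by
      refine indepFun_of_dependsOn (g := fun s => s l') (T := {l'}) hind hS ?_
        (measurable_limitVariance σb σv x l hl) (dependsOn_limitVariance σb σv x l hl)
        (measurable_pi_apply l') fun s s' hs => hs l' rfl
      simp [l']
    have hp := (indepFun_iff_map_prod_eq_prod_map_map hV.aemeasurable (hS l').aemeasurable).1 hi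
    rw [varianceLaw, ← ih hl, ← hp,
      Measure.map_map (continuous_varianceStep σb σv).measurable (hV.prodMk (hS l'))]
    rfl

end LimitVariance

/-- If `X` is measurable with respect to `m` and `S` is independent of `m`, then conditionally on
`m` an event about `(X, S)` has the probability obtained by freezing `X`. -/
lemma condExp_indicator_of_indep {Ω : Type*} {m m₀ : MeasurableSpace Ω} (hm : m ≤ m₀)
    {Q : Measure Ω} [IsProbabilityMeasure Q] {X S : Ω → ℝ} (hS : Measurable S)
    (hX : Measurable[m] X) (hind : Indep m (MeasurableSpace.comap S inferInstance) Q)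
    {B : Set (ℝ × ℝ)} (hB : MeasurableSet B) :
    Q⟦(fun ω => (X ω, S ω)) ⁻¹' B | m⟧ =ᵐ[Q] fun ω => (Q.map S).real (Prod.mk (X ω) ⁻¹' B) := by
  have hX₀ : Measurable X := hX.mono hm le_rfl
  have : IsProbabilityMeasure (Q.map S) := Measure.isProbabilityMeasure_map hS.aemeasurable
  have hBm : MeasurableSet ((fun ω => (X ω, S ω)) ⁻¹' B) := (hX₀.prodMk hS) hB
  have hslice : Measurable fun v : ℝ => (Q.map S) (Prod.mk v ⁻¹' B) :=
    measurable_measure_prodMk_left hB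
  have hg : Measurable[m] fun ω => (Q.map S).real (Prod.mk (X ω) ⁻¹' B) :=
    hslice.ennreal_toReal.comp hX
  have hgi : Integrable (fun ω => (Q.map S).real (Prod.mk (X ω) ⁻¹' B)) Q := by
    refine (integrable_const (1 : ℝ)).mono' (hg.mono hm le_rfl).aestronglyMeasurable ?_
    exact Eventually.of_forall fun ω => by
      rw [Real.norm_of_nonneg measureReal_nonneg]; exact measureReal_le_one
  symm
  refine ae_eq_condExp_of_forall_setIntegral_eq hm
    ((integrable_const (1 : ℝ)).indicator hBm) (fun _ _ _ => hgi.integrableOn) ?_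
    hg.stronglyMeasurable.aestronglyMeasurable
  intro C hC _
  have hC₀ := hm C hC
  -- The joint law of `(1_C, X)` and `S` is a product measure.
  let Y : Ω → ℝ × ℝ := fun ω => (C.indicator 1 ω, X ω)
  have hC1 : Measurable[m] (C.indicator (1 : Ω → ℝ)) := Measurable.indicator measurable_const hC
  have hY : Measurable[m] Y := Measurable.prodMk (m := m) hC1 hX
  have hY₀ : Measurable Y := hY.mono hm le_rfl
  have hYS : IndepFun Y S Q := indep_of_indep_of_le_left hind hY.comap_le
  have hp := (indepFun_iff_map_prod_eq_prod_map_map hY₀.aemeasurable hS.aemeasurable).1 hYS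
  let D : Set ((ℝ × ℝ) × ℝ) := {q | q.1.1 = 1 ∧ (q.1.2, q.2) ∈ B}
  have hD : MeasurableSet D :=
    (measurableSet_eq_fun (by fun_prop) measurable_const).inter
      ((show Measurable fun q : (ℝ × ℝ) × ℝ => (q.1.2, q.2) by fun_prop) hB)
  have h1 : Q (((fun ω => (X ω, S ω)) ⁻¹' B) ∩ C) =
      ∫⁻ ω in C, (Q.map S) (Prod.mk (X ω) ⁻¹' B) ∂Q := by
    have e1 : (fun ω => (Y ω, S ω)) ⁻¹' D = ((fun ω => (X ω, S ω)) ⁻¹' B) ∩ C := by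
      ext ω
      by_cases hω : ω ∈ C <;> simp [D, Y, hω]
    rw [← e1, ← Measure.map_apply (hY₀.prodMk hS) hD, hp, Measure.prod_apply hD,
      lintegral_map (measurable_measure_prodMk_left hD) hY₀, ← lintegral_indicator hC₀]
    refine lintegral_congr fun ω => ?_
    by_cases hω : ω ∈ C
    · simp only [D, Y, hω, Set.indicator_of_mem, Pi.one_apply, Set.preimage_ofPred_eq, true_and]
      rfl
    · simp [D, Y, hω]
  rw [integral_indicator_const _ hBm, smul_eq_mul, mul_one, measureReal_restrict_apply hBm,
    measureReal_def, h1]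
  exact integral_toReal (hslice.comp hX₀).aemeasurable
    (Eventually.of_forall fun ω => measure_lt_top _ _)

/-- A sequence built by the recursion `X (i + 1) = f (X i, S i)`, with innovations `S i` that are
independent of the past, is a Markov sequence. -/
lemma isMarkovSequence_of_recursion {Ω : Type*} [mΩ : MeasurableSpace Ω] {Q : Measure Ω}
    [IsProbabilityMeasure Q] {n : ℕ} {X : Fin (n + 1) → Ω → ℝ} (hX : ∀ i, Measurable (X i))
    {S : Fin n → Ω → ℝ} (hS : ∀ i, Measurable (S i)) {f : ℝ × ℝ → ℝ} (hf : Measurable f)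
    (hstep : ∀ i : Fin n, X i.succ = fun ω => f (X i.castSucc ω, S i ω))
    (hind : ∀ i : Fin n,
      IndepFun (fun ω (j : {j : Fin (n + 1) // j ≤ i.castSucc}) => X j ω) (S i) Q) :
    IsMarkovSequence X Q := by
  refine ⟨hX, fun i A hA => ?_⟩
  have hpre : X i.succ ⁻¹' A = (fun ω => (X i.castSucc ω, S i ω)) ⁻¹' (f ⁻¹' A) := by
    rw [hstep]; rfl
  set past : MeasurableSpace Ω :=
    ⨆ j : {j : Fin (n + 1) // j ≤ i.castSucc}, MeasurableSpace.comap (X j) inferInstance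
  have hpast_le : past ≤ MeasurableSpace.comap
      (fun ω (j : {j : Fin (n + 1) // j ≤ i.castSucc}) => X j ω) inferInstance := by
    refine iSup_le fun j => ?_
    rintro _ ⟨B, hB, rfl⟩
    exact ⟨(fun w => w j) ⁻¹' B, measurable_pi_apply j hB, rfl⟩
  have hpast : Indep past (MeasurableSpace.comap (S i) inferInstance) Q :=
    indep_of_indep_of_le_left (hind i) hpast_le
  have hcur_le : MeasurableSpace.comap (X i.castSucc) inferInstance ≤ past :=
    le_iSup (fun j : {j : Fin (n + 1) // j ≤ i.castSucc} =>
      MeasurableSpace.comap (X j) inferInstance) ⟨i.castSucc, le_rfl⟩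
  have hcur : Indep (MeasurableSpace.comap (X i.castSucc) inferInstance)
      (MeasurableSpace.comap (S i) inferInstance) Q := indep_of_indep_of_le_left hpast hcur_le
  have hpast_le' : past ≤ mΩ := iSup_le fun j => (hX j.1).comap_le
  have hXpast : Measurable[past] (X i.castSucc) :=
    (comap_measurable (X i.castSucc)).mono hcur_le le_rfl
  rw [hpre]
  exact (condExp_indicator_of_indep (m := past) hpast_le' (hS i) hXpast hpast (hf hA)).trans
    (condExp_indicator_of_indep (hX i.castSucc).comap_le (hS i)
      (comap_measurable (X i.castSucc)) hcur (hf hA)).symm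

lemma isMarkovSequence_limitVariance {din L : ℕ} (σb σv : ℝ≥0) (x : EuclideanSpace ℝ (Fin din))
    {Ω : Type*} [MeasurableSpace Ω] {Q : Measure Ω} [IsProbabilityMeasure Q]
    {S : Fin L → Ω → ℝ} (hS : ∀ l, Measurable (S l)) (hind : iIndepFun S Q) :
    IsMarkovSequence (fun (l : Fin (L + 1)) ω =>
      limitVariance σb σv x (fun i => S i ω) l l.isLt) Q := by
  refine isMarkovSequence_of_recursion
    (fun l => measurable_limitVariance_comp σb σv x hS l l.isLt) hS
    (continuous_varianceStep σb σv).measurable (fun i => rfl) fun i => ?_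
  refine indepFun_of_dependsOn (S := {k | k < i}) (T := {i}) hind hS (by simp)
    (f := fun s (j : {j : Fin (L + 1) // j ≤ i.castSucc}) =>
      limitVariance σb σv x s j j.1.isLt) ?_ ?_
    (g := fun s => s i) (measurable_pi_apply i) fun s s' hs => hs i rfl
  · exact measurable_pi_iff.2 fun j => measurable_limitVariance σb σv x _ _
  · intro s s' hs
    funext j
    refine dependsOn_limitVariance σb σv x _ _ fun k hk => hs k ?_
    exact Fin.lt_def.2 (lt_of_lt_of_le hk j.2)

/-! ### The infinite-width limit -/

section Limit

variable {φ : ℝ → ℝ} (hφ : PositiveHomogeneous φ)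

/-- Passage from widths in `ℕ+` to a sequence indexed by `ℕ`; the value `Nat.toPNat' 0 = 1` only
affects the term of index zero. -/
lemma ConvergesInLaw.toPNat' {m : ℕ+ → Measure ℝ} [∀ n, IsProbabilityMeasure (m n)]
    {Λ : Measure ℝ} (h : ConvergesInLaw (fun n : ℕ+ => iidSumLaw (m n) n) atTop Λ) :
    ConvergesInLaw (fun n : ℕ => iidSumLaw (m n.toPNat') n) atTop Λ := by
  have ht : Tendsto Nat.toPNat' atTop atTop := by
    refine tendsto_atTop_atTop.2 fun b => ⟨b, fun n hn => ?_⟩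
    have hpos : 0 < n := b.pos.trans_le hn
    rw [← PNat.coe_le_coe, Nat.toPNat'_coe, if_pos hpos]
    exact hn
  refine (h.comp ht).congr (fun n => isProbabilityMeasure_iidSumLaw _ _) ?_
  filter_upwards [eventually_gt_atTop 0] with n hn
  rw [Nat.toPNat'_coe, if_pos hn]

include hφ

lemma convergesInLaw_multiplierLaw {L : ℕ} {μ : Fin L → ℕ+ → Measure ℝ}
    [∀ l n, IsProbabilityMeasure (μ l n)] (hμ : ∀ l n, μ l n (Set.Iio 0) = 0) (l : Fin L)
    {Λ : Measure ℝ} {a : ℝ} {ρ : Measure ℝ} (hΛ : IsIDLaw Λ a ρ)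
    (hconv : ConvergesInLaw (fun n : ℕ+ => iidSumLaw (μ l n) n) atTop Λ) {ν : Measure ℝ}
    (hν : IsIDLaw ν (a * gaussianMeanSq φ) (activatedLevy φ ρ)) :
    ConvergesInLaw (fun p : Fin L → ℕ+ => multiplierLaw φ μ p l) atTop ν := by
  have h1 := convergesInLaw_iidSumLaw_activatedLaw hφ (m := fun n => μ l n.toPNat')
    (fun n => hμ l _) hΛ hconv.toPNat' hν
  have ht : Tendsto (fun p : Fin L → ℕ+ => (p l : ℕ)) atTop atTop :=
    tendsto_PNat_val_atTop_atTop.comp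
      (tendsto_atTop_atTop.2 fun b => ⟨fun _ => b, fun p hp => hp l⟩)
  simpa only [PNat.coe_toPNat', multiplierLaw] using h1.comp ht

end Limit

end WideNet

open WideNet in
theorem mainTheorem1
    (L din dout : ℕ) (hdin : 0 < din) (σb σv : ℝ≥0) (hσv : 0 < σv)
    (φ : ℝ → ℝ) (hφ : WideNet.PositiveHomogeneous φ)
    -- the laws of the node variances: `μ l n` for hidden layer `l + 1` of width `n`
    (μ : Fin L → ℕ+ → Measure ℝ) [∀ l n, IsProbabilityMeasure (μ l n)]
    (hμ : ∀ l n, μ l n (Set.Iio 0) = 0)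
    -- the sums of the node variances converge in distribution to `ID(a l, ρ l)`
    (a : Fin L → ℝ) (ρ : Fin L → Measure ℝ) (Λ : Fin L → Measure ℝ)
    (hΛ : ∀ l, WideNet.IsIDLaw (Λ l) (a l) (ρ l))
    (hconv : ∀ l, WideNet.ConvergesInLaw
      (fun n : ℕ+ => WideNet.iidSumLaw (μ l n) n) atTop (Λ l))
    -- one random network for each vector `p` of hidden widths
    (Ω : (Fin L → ℕ+) → Type*) [∀ p, MeasurableSpace (Ω p)]
    (P : ∀ p, Measure (Ω p)) [∀ p, IsProbabilityMeasure (P p)]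
    (θ : ∀ p : Fin L → ℕ+, WideNet.ParamIdx din dout p → Ω p → ℝ)
    (hθ : ∀ p, WideNet.IsRandomNetwork p σb σv μ (P p) (θ p)) :
    Integrable (fun z => φ z ^ 2 * gaussianPDFReal 0 1 z) ∧
    ∃ η : Fin L → Measure ℝ,
      (∀ l, WideNet.IsLevyMeasure (η l)) ∧
      (∀ l, ∀ x : ℝ, 0 < x → η l (Set.Ioi x) =
        ∫⁻ z in {z | φ z ≠ 0}, ρ l (Set.Ioi (x / φ z ^ 2)) * gaussianPDF 0 1 z) ∧
      (∀ l, ∃ ν : Measure ℝ, WideNet.IsIDLaw ν (a l * WideNet.gaussianMeanSq φ) (η l)) ∧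
      ∀ (Ω' : Type*) [MeasurableSpace Ω'] (Q : Measure Ω') [IsProbabilityMeasure Q]
        (S : Fin L → Ω' → ℝ), (∀ l, Measurable (S l)) → iIndepFun S Q →
        (∀ l, WideNet.IsIDLaw (Q.map (S l)) (a l * WideNet.gaussianMeanSq φ) (η l)) →
        ∀ x : EuclideanSpace ℝ (Fin din),
          (∀ l : Fin (L + 1), ∀ᵐ ω ∂Q,
            0 ≤ WideNet.limitVariance σb σv x (fun i => S i ω) l l.isLt) ∧
          WideNet.IsMarkovSequence
            (fun (l : Fin (L + 1)) ω =>
              WideNet.limitVariance σb σv x (fun i => S i ω) l l.isLt) Q ∧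
          -- `atTop` on `Fin L → ℕ+` is the limit in which the smallest hidden width tends to `∞`
          ∀ (l : Fin (L + 1)) (m : ℕ), (l = Fin.last L → m ≤ dout) →
            WideNet.ConvergesInLaw
              (fun p => (P p).map (fun ω =>
                WideNet.firstPreacts φ x l m (fun i => θ p i ω)))
              atTop
              (WideNet.gaussianMixture Q
                (fun ω => WideNet.limitVariance σb σv x (fun i => S i ω) l l.isLt) m) := by
  refine ⟨hφ.integrable_sq_mul_pdf, fun l => activatedLevy φ (ρ l),
    fun l => isLevyMeasure_activatedLevy hφ (hΛ l).isLevyMeasure,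
    fun l x hx => activatedLevy_Ioi hφ (hΛ l).isLevyMeasure hx,
    fun l => exists_isIDLaw_activatedLevy hφ (m := fun n => μ l n.toPNat') (fun n => hμ l _) (hΛ l)
      (hconv l).toPNat', ?_⟩
  intro Ω' _ Q _ S hS hind hID x
  refine ⟨fun l => ?_, isMarkovSequence_limitVariance σb σv x hS hind, fun l m hm => ?_⟩
  · have hnn : ∀ᵐ ω ∂Q, ∀ i, 0 ≤ S i ω := ae_all_iff.2 fun i =>
      ae_of_ae_map (hS i).aemeasurable (ae_nonneg_of_null_neg (hID i).null_neg)
    filter_upwards [hnn] with ω hω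
    exact limitVariance_nonneg σb σv x hω l l.isLt
  · have hV := measurable_limitVariance_comp σb σv x hS l l.isLt
    have hlim := (convergesInLaw_varianceLaw σb σv (inputVariance σb σv x)
      (fun i => convergesInLaw_multiplierLaw hφ hμ i (hΛ i) (hconv i) (hID i)) l
      l.isLt).gaussianMixture m
    rw [← map_limitVariance σb σv x hS hind l l.isLt, gaussianMixture_map_id Q hV] at hlim
    -- The exact law of the finite network, transferred to the space of parameters.
    have hlaw p : (P p).map (fun ω => firstPreacts φ x l m (fun i => θ p i ω)) =
        (Measure.pi (ParamIdx.law σb σv μ : ParamIdx din dout p → Measure ℝ)).map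
          (firstPreacts φ x l m) := by
      have hθm i := ((hθ p).hasLaw σb σv μ i).aemeasurable
      have e := (hθ p).indep.map_fun_eq_pi_map hθm
      simp only [((hθ p).hasLaw σb σv μ _).map_eq] at e
      rw [← e, AEMeasurable.map_map_of_aemeasurable
        (measurable_firstPreacts x hφ l m).aemeasurable (aemeasurable_pi_lambda _ hθm)]
      rfl
    have hwidth : ∀ᶠ p : Fin L → ℕ+ in atTop, m ≤ layerWidth din dout p (l + 1) := by
      by_cases hl : (l : ℕ) < L
      · filter_upwards [eventually_ge_atTop (fun _ : Fin L => m.toPNat')] with p hp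
        have h1 : (m.toPNat' : ℕ) ≤ p ⟨l, hl⟩ := hp ⟨l, hl⟩
        have h2 : m ≤ (m.toPNat' : ℕ) := by
          rw [Nat.toPNat'_coe]; split_ifs <;> omega
        simpa [layerWidth, hl] using h2.trans h1
      · have : l = Fin.last L := Fin.ext (by have := l.isLt; simp; omega)
        exact Eventually.of_forall fun p => by simpa [layerWidth, hl] using hm this
    refine hlim.congr (fun p => ?_) (hwidth.mono fun p hp => ?_)
    · rw [hlaw p]
      exact Measure.isProbabilityMeasure_map (measurable_firstPreacts x hφ l m).aemeasurable
    · rw [hlaw p, map_firstPreacts x σb σv μ hφ hμ l hp]
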